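/- **Notation.** Let $\mathcal D$ be the set of all $\Psi=(\psi_1,\dots,\psi_K)$ with $\psi_i\in\mathbb R^d$, $\|\psi_i\|_2=1$, identified with $d\times K$ matrices. For a probability measure $\nu$ on the unit sphere $S^{K-1}\subset\mathbb R^K$ and a fixed $\Phi=(\varphi_1,\dots,\varphi_K)\in\mathcal D$, consider on $\mathcal D$ the function $F(\Psi)=\mathbb E_{x\sim\nu}\|\Psi^\star\Phi x\|_\infty^2=\mathbb E_x\max_i|\langle\psi_i,\Phi x\rangle|^2$. The measure $\nu$ is *symmetric* if it is invariant under all coordinate permutations and all sign changes $x\mapsto(\sigma_1x_1,\dots,\sigma_Kx_K)$, $\sigma\in\{-1,1\}^K$. Let $c_1(x)\ge c_2(x)\ge\dots\ge c_K(x)\ge0$ be the non-increasing rearrangement of $|x_1|,\dots,|x_K|$ (with $c_2(x):=0$ if $K=1$). For $\mu\ge 0$ and $\beta<1/2$, $\nu$ is *$(\beta,\mu)$-decaying* if $$\nu\left(\frac{c_2(x)+\mu\|c(x)\|_1}{c_2(x)+c_1(x)}\le\beta\right)=1 .$$ For $f:(0,\infty)\to[0,\infty)$, $\nu$ is *$f$-decaying*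 if, as $\varepsilon\to0^+$, $$\exp\left(-\frac{f(\varepsilon)^2}{8\varepsilon^2}\right)=o(\varepsilon^2)\quad\text{and}\quad \nu\left(\frac{c_2(x)}{c_1(x)}\ge1-f(\varepsilon)\right)=o(\varepsilon^2).$$ **Theorem.** (a) Let $\Phi=(\varphi_1,\dots,\varphi_K)$ be a unit norm tight frame of $\mathbb R^d$, that is, $\|\varphi_i\|_2=1$ and $\sum_i|\langle\varphi_i,v\rangle|^2=A\|v\|_2^2$ for all $v$, where necessarily $A=K/d$, and let $\mu=\max_{i\ne j}|\langle\varphi_i,\varphi_j\rangle|$ be its coherence ($\mu=0$ if $K=1$). Let $\nu$ be a symmetric $(\beta,\mu)$-decaying probability measure on $S^{K-1}$, where $\beta<1/2$. Then $F$, restricted to $\mathcal D$, has a local maximum at $\Phi$. Moreover, put $\bar c_1^2:=\mathbb E_x\|x\|_\infty^2$. For every $\Psi=(\psi_1,\dots,\psi_K)\in\mathcal D$ and every $\varepsilon$ with $0<\max_i\|\psi_i-\varphi_i\|_2\le\varepsilon$ we have $$\mathbb E_x\|\Psi^\star\Phi x\|_\infty^2<\mathbb E_x\|\Phi^\star\Phi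 x\|_\infty^2$$ as soon as $\varepsilon<1/5$ and $$\varepsilon\le\frac{(1-2\beta)^2}{2A\log\left(2AK\Big/\left(\bar c_1^2-\frac{1-\bar c_1^2}{K-1}\right)\right)} .$$ (For $K=1$ the fraction $\frac{1-\bar c_1^2}{K-1}$ is read as $0$; in that case no such $\Psi$ exists.) (b) Let $K=d$, let $\Phi$ be an orthonormal basis of $\mathbb R^d$, and let $\nu$ be a symmetric probability measure on $S^{d-1}$ that is $f$-decaying for some $f:(0,\infty)\to[0,\infty)$. Then $F$, restricted to $\mathcal D$, has a local maximum at $\Phi$. -/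

import Mathlib

open MeasureTheory Filter Topology Asymptotics

noncomputable section

namespace KSVD

/-- `ℝⁿ` with the Euclidean norm. -/
abbrev E (n : ℕ) : Type := EuclideanSpace ℝ (Fin n)

/-- The unit sphere `S^{n-1} ⊂ ℝⁿ`. -/
abbrev Sph (n : ℕ) : Type := Metric.sphere (0 : E n) 1

variable {d K : ℕ}

/-! ### Dictionaries and frames -/

/-- The set `𝒟` of dictionaries: `K`-tuples of unit norm vectors (atoms) in `ℝᵈ`. -/
def dictionaries (d K : ℕ) : Set (Fin K → E d) := {Φ | ∀ i, ‖Φ i‖ = 1}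

/-- `Φ` is a frame of `ℝᵈ` with frame bounds `A, B > 0`. -/
def IsFrameWithBounds (Φ : Fin K → E d) (A B : ℝ) : Prop :=
  0 < A ∧ 0 < B ∧ ∀ v : E d,
    A * ‖v‖ ^ 2 ≤ ∑ i, |inner ℝ (Φ i) v| ^ 2 ∧ ∑ i, |inner ℝ (Φ i) v| ^ 2 ≤ B * ‖v‖ ^ 2

/-- `Φ` is a tight frame: the two frame bounds can be chosen equal. -/
def IsTightFrame (Φ : Fin K → E d) : Prop := ∃ A : ℝ, IsFrameWithBounds Φ A A

/-- Coherence `max_{i ≠ j} |⟨φ_i, φ_j⟩|` (it is `0` for a single atom). -/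
def coherence (Φ : Fin K → E d) : ℝ :=
  ⨆ p : {p : Fin K × Fin K // p.1 ≠ p.2}, |inner ℝ (Φ p.1.1) (Φ p.1.2)|

/-- The synthesis `Φ x = ∑ⱼ xⱼ φⱼ`. -/
def synth (Φ : Fin K → E d) (x : E K) : E d := ∑ j, x j • Φ j

/-- The analysis `Ψ⋆ y = (⟨ψ_i, y⟩)_i`, a vector in `ℝᴷ` carrying the sup norm. -/
def analysis (Ψ : Fin K → E d) (y : E d) : Fin K → ℝ := fun i => inner ℝ (Ψ i) y

/-- The criterion `Ψ ↦ 𝔼_y ‖Ψ⋆ y‖_∞²` for signals `y = Φ x` with `x` distributed as `ν`. -/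
def criterion (ν : Measure (Sph K)) (Φ Ψ : Fin K → E d) : ℝ :=
  ∫ x : Sph K, ‖analysis Ψ (synth Φ x.1)‖ ^ 2 ∂ν

/-- `𝔼_x ‖x‖_∞²` for `x` distributed as `ν`. -/
def meanSupSq (ν : Measure (Sph K)) : ℝ :=
  ∫ x : Sph K, ‖(fun i => x.1 i : Fin K → ℝ)‖ ^ 2 ∂ν

/-! ### Non-increasing rearrangement of the absolute values -/

/-- The non-increasing rearrangement of `(|x_1|, …, |x_K|)`. -/
def rearr (x : E K) : Fin K → ℝ := fun i => |x (Tuple.sort (fun j => -|x j|) i)|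

theorem rearr_antitone (x : E K) : Antitone (rearr x) := by
  intro i j hij
  have h := Tuple.monotone_sort (fun j => -|x j|) hij
  simpa [rearr] using h

theorem exists_perm_rearr (x : E K) : ∃ p : Equiv.Perm (Fin K), ∀ i, rearr x i = |x (p i)| :=
  ⟨Tuple.sort (fun j => -|x j|), fun _ => rfl⟩

/-- The largest absolute value `c₁(x)`. -/
def c₁ (x : E K) : ℝ := if h : 0 < K then rearr x ⟨0, h⟩ else 0

/-- The second largest absolute value `c₂(x)`, counted with multiplicity (`0` if `K = 1`). -/
def c₂ (x : E K) : ℝ := if h : 1 < K then rearr x ⟨1, h⟩ else 0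

/-! ### Symmetric and decaying distributions on the sphere -/

/-- `(σ_1 x_1, …, σ_n x_n)` for a sign sequence `σ`. -/
def signFlip (σ : Fin K → ℤˣ) (x : Sph K) : Sph K :=
  ⟨WithLp.toLp 2 fun i => ((σ i : ℤ) : ℝ) * x.1 i, by
    have hx : ‖x.1‖ = 1 := by simp
    have h : ∀ i, |((σ i : ℤ) : ℝ)| = 1 := fun i => by
      rcases Int.units_eq_one_or (σ i) with h | h <;> simp [h]
    rw [EuclideanSpace.norm_eq] at hx
    simpa [EuclideanSpace.norm_eq, abs_mul, mul_pow, h] using hx⟩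

/-- `(x_{p(1)}, …, x_{p(n)})` for a permutation `p`. -/
def permute (p : Equiv.Perm (Fin K)) (x : Sph K) : Sph K :=
  ⟨WithLp.toLp 2 fun i => x.1 (p i), by
    have hx : ‖x.1‖ = 1 := by simp
    rw [EuclideanSpace.norm_eq, ← Equiv.sum_comp p] at hx
    simpa [EuclideanSpace.norm_eq] using hx⟩

/-- `ν` is invariant under all sign changes and all permutations of the coordinates. -/
def IsSymmetric (ν : Measure (Sph K)) : Prop :=
  ∀ X : Set (Sph K), MeasurableSet X →
    (∀ σ : Fin K → ℤˣ, ν (signFlip σ '' X) = ν X) ∧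
    (∀ p : Equiv.Perm (Fin K), ν (permute p '' X) = ν X)

/-- `(β, μ)`-decaying: `β < 1/2` and `(c₂ + μ ‖c‖₁) / (c₂ + c₁) ≤ β` with probability one. -/
def IsDecaying (ν : Measure (Sph K)) (β μ : ℝ) : Prop :=
  β < 1 / 2 ∧
    ∀ᵐ x : Sph K ∂ν, (c₂ x.1 + μ * ∑ i, rearr x.1 i) / (c₂ x.1 + c₁ x.1) ≤ β

/-- `f`-decaying, for a non-negative function `f` on the positive reals. -/
def IsFDecaying (ν : Measure (Sph K)) (f : ℝ → ℝ) : Prop :=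
  (∀ ε, 0 < ε → 0 ≤ f ε) ∧
  (fun ε : ℝ => Real.exp (-(f ε ^ 2 / (8 * ε ^ 2)))) =o[𝓝[>] 0] (fun ε : ℝ => ε ^ 2) ∧
  (fun ε : ℝ => ν.real {x : Sph K | c₂ x.1 / c₁ x.1 ≥ 1 - f ε}) =o[𝓝[>] 0] (fun ε : ℝ => ε ^ 2)

end KSVD

end

open MeasureTheory Filter Topology Asymptotics

namespace KSVD

variable {d K : ℕ} {ν : Measure (Sph K)}

/-! ### Invariance under signed permutations -/

/-! Almost every coefficient vector has a unique strictly dominant coordinate. Let `lead Φ Ψ x` be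
the squared response to `Φ x` of the atom of `Ψ` carrying that index. It never exceeds the squared
sup norm, so the criterion at `Φ` is at least the mean of `lead Φ Φ`.

Sign symmetry kills the mixed second moments on each dominance set, and permutation symmetry leaves
only two diagonal values. With the tight frame identity the mean of `lead Φ Ψ` becomes explicit:
passing from `Φ` to `Ψ` costs exactly `momentGap ν / K` times the sum of `1 - ⟨ψ_i, φ_i⟩²`
(`integral_lead_sub`), which is quadratic in the displacement.

Conversely, the dominant atom of `Ψ` still attains the maximum unless some difference `ψ_j - φ_j`
responds by more than `m ‖x‖_∞`, where `2 m ‖x‖_∞` is the margin by which the dominant atom of `Φ`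
wins. This costs at most `A` times the probabilities of these deviations (`criterion_le_lead`).
Averaging over random signs gives them a Gaussian tail in `1 / ‖ψ_j - φ_j‖`
(`measureReal_deviation_le`), which the quadratic loss beats for small displacements.

For (a), decay supplies the margin almost surely and the comparison is made atom by atom. The stated
radius needs sharp numerics: the tail estimate serves `K ≥ 32`, while for `2 ≤ K ≤ 31` the
deviations are null events. For (b), the margin depends on `ε`, and the set where it fails has
probability `o(ε²)`. -/

theorem continuous_coord (i : Fin K) : Continuous fun x : Sph K => x.1 i := by fun_prop

theorem signFlip_apply (σ : Fin K → ℤˣ) (x : Sph K) (i : Fin K) :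
    (signFlip σ x).1 i = ((σ i : ℤ) : ℝ) * x.1 i := rfl

theorem permute_apply (p : Equiv.Perm (Fin K)) (x : Sph K) (i : Fin K) :
    (permute p x).1 i = x.1 (p i) := rfl

theorem continuous_signFlip (σ : Fin K → ℤˣ) : Continuous (signFlip σ) := by
  unfold signFlip
  fun_prop

theorem continuous_permute (p : Equiv.Perm (Fin K)) : Continuous (permute p) := by
  unfold permute
  fun_prop

theorem abs_units_cast (u : ℤˣ) : |((u : ℤ) : ℝ)| = 1 := by
  rcases Int.units_eq_one_or u with h | h <;> simp [h]

theorem units_cast_mul_self (u : ℤˣ) : ((u : ℤ) : ℝ) * ((u : ℤ) : ℝ) = 1 := by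
  rcases Int.units_eq_one_or u with h | h <;> simp [h]

theorem signFlip_involutive (σ : Fin K → ℤˣ) : Function.Involutive (signFlip σ) := by
  intro x
  apply Subtype.ext
  ext i
  rw [signFlip_apply, signFlip_apply, ← mul_assoc, units_cast_mul_self, one_mul]

theorem permute_permute_inv (p : Equiv.Perm (Fin K)) (x : Sph K) :
    permute p (permute p⁻¹ x) = x := by
  apply Subtype.ext
  ext i
  simp [permute_apply]

theorem permute_inv_permute (p : Equiv.Perm (Fin K)) (x : Sph K) :
    permute p⁻¹ (permute p x) = x := by
  simpa using permute_permute_inv p⁻¹ x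

theorem IsSymmetric.measurePreserving_signFlip {ν : Measure (Sph K)} (h : IsSymmetric ν)
    (σ : Fin K → ℤˣ) : MeasurePreserving (signFlip σ) ν ν := by
  refine ⟨(continuous_signFlip σ).measurable, Measure.ext fun X hX => ?_⟩
  rw [Measure.map_apply (continuous_signFlip σ).measurable hX, ← (h X hX).1 σ,
    Set.image_eq_preimage_of_inverse (signFlip_involutive σ) (signFlip_involutive σ)]

theorem IsSymmetric.measurePreserving_permute {ν : Measure (Sph K)} (h : IsSymmetric ν)
    (p : Equiv.Perm (Fin K)) : MeasurePreserving (permute p) ν ν := by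
  refine ⟨(continuous_permute p).measurable, Measure.ext fun X hX => ?_⟩
  rw [Measure.map_apply (continuous_permute p).measurable hX, ← (h X hX).2 p⁻¹,
    Set.image_eq_preimage_of_inverse (permute_permute_inv p) (permute_inv_permute p)]

theorem IsSymmetric.integral_signFlip {ν : Measure (Sph K)} (h : IsSymmetric ν)
    (σ : Fin K → ℤˣ) {f : Sph K → ℝ} (hf : Measurable f) :
    ∫ x, f (signFlip σ x) ∂ν = ∫ x, f x ∂ν := by
  have hm := h.measurePreserving_signFlip σ
  conv_rhs => rw [← hm.map_eq]
  exact (integral_map hm.measurable.aemeasurable hf.aestronglyMeasurable).symm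

theorem IsSymmetric.integral_permute {ν : Measure (Sph K)} (h : IsSymmetric ν)
    (p : Equiv.Perm (Fin K)) {f : Sph K → ℝ} (hf : Measurable f) :
    ∫ x, f (permute p x) ∂ν = ∫ x, f x ∂ν := by
  have hm := h.measurePreserving_permute p
  conv_rhs => rw [← hm.map_eq]
  exact (integral_map hm.measurable.aemeasurable hf.aestronglyMeasurable).symm

/-! ### Coefficients with a dominant coordinate -/

/-- The coefficient vectors whose strictly largest absolute value sits at the coordinate `i`. -/
def topSet (i : Fin K) : Set (Sph K) := {x | ∀ j, j ≠ i → |x.1 j| < |x.1 i|}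

theorem measurableSet_topSet (i : Fin K) : MeasurableSet (topSet i) := by
  have : topSet i = ⋂ j, ⋂ (_ : j ≠ i), {x : Sph K | |x.1 j| < |x.1 i|} := by
    ext x; simp [topSet]
  rw [this]
  exact MeasurableSet.iInter fun j => MeasurableSet.iInter fun _ =>
    (isOpen_lt (continuous_coord j).abs (continuous_coord i).abs).measurableSet

theorem signFlip_mem_topSet (σ : Fin K → ℤˣ) (x : Sph K) (i : Fin K) :
    signFlip σ x ∈ topSet i ↔ x ∈ topSet i := by
  simp [topSet, signFlip_apply, abs_mul, abs_units_cast]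

theorem permute_mem_topSet (p : Equiv.Perm (Fin K)) (x : Sph K) (i : Fin K) :
    permute p x ∈ topSet i ↔ x ∈ topSet (p i) := by
  simp only [topSet, permute_apply, Set.mem_ofPred_eq]
  refine ⟨fun h j hj => ?_, fun h j hj => h (p j) fun e => hj (p.injective e)⟩
  have := h (p⁻¹ j) (fun e => hj (by simp [← e]))
  simpa using this

theorem eq_of_mem_topSet {x : Sph K} {i j : Fin K} (hi : x ∈ topSet i) (hj : x ∈ topSet j) :
    i = j := by
  by_contra h
  exact lt_asymm (hi j (Ne.symm h)) (hj i h)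

theorem sum_indicator_topSet {x : Sph K} {i : Fin K} (hi : x ∈ topSet i)
    (f : Fin K → Sph K → ℝ) : ∑ k, (topSet k).indicator (f k) x = f i x := by
  rw [Finset.sum_eq_single i]
  · simp [hi]
  · intro k _ hk
    exact Set.indicator_of_notMem (fun h => hk (eq_of_mem_topSet h hi)) _
  · simp

theorem sum_sq_coord (x : Sph K) : ∑ i, (x.1 i) ^ 2 = 1 := by
  have h := EuclideanSpace.norm_sq_eq x.1
  have hx : ‖x.1‖ = 1 := by simp
  rw [hx] at h
  simpa using h.symm

theorem abs_coord_le_one (x : Sph K) (i : Fin K) : |x.1 i| ≤ 1 := by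
  have h := Finset.single_le_sum (fun j _ => sq_nonneg (x.1 j)) (Finset.mem_univ i)
  rw [sum_sq_coord] at h
  exact (sq_le_one_iff_abs_le_one _).1 h

/-- The largest absolute value of the coordinates. -/
noncomputable def supNorm (x : Sph K) : ℝ := ‖(fun i => x.1 i : Fin K → ℝ)‖

theorem continuous_supNorm : Continuous (supNorm : Sph K → ℝ) := by
  unfold supNorm
  fun_prop

theorem abs_coord_le_supNorm (x : Sph K) (i : Fin K) : |x.1 i| ≤ supNorm x :=
  norm_le_pi_norm (fun i => x.1 i : Fin K → ℝ) i

theorem supNorm_nonneg (x : Sph K) : 0 ≤ supNorm x := norm_nonneg _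

theorem supNorm_le_one (x : Sph K) : supNorm x ≤ 1 :=
  (pi_norm_le_iff_of_nonneg zero_le_one).2 fun i => abs_coord_le_one x i

theorem supNorm_pos (x : Sph K) : 0 < supNorm x := by
  refine (supNorm_nonneg x).lt_of_ne fun h => ?_
  have h1 := sum_sq_coord x
  have h2 : ∀ i, x.1 i = 0 := fun i =>
    abs_nonpos_iff.1 (by rw [h]; exact abs_coord_le_supNorm x i)
  simp [h2] at h1

theorem supNorm_signFlip (σ : Fin K → ℤˣ) (x : Sph K) : supNorm (signFlip σ x) = supNorm x := by
  refine le_antisymm ((pi_norm_le_iff_of_nonneg (supNorm_nonneg x)).2 fun i => ?_)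
    ((pi_norm_le_iff_of_nonneg (supNorm_nonneg _)).2 fun i => ?_)
  · simpa [signFlip_apply, abs_mul, abs_units_cast] using abs_coord_le_supNorm x i
  · simpa [signFlip_apply, abs_mul, abs_units_cast] using abs_coord_le_supNorm (signFlip σ x) i

theorem supNorm_eq_of_mem_topSet {x : Sph K} {i : Fin K} (h : x ∈ topSet i) :
    supNorm x = |x.1 i| := by
  refine le_antisymm ((pi_norm_le_iff_of_nonneg (abs_nonneg _)).2 fun j => ?_)
    (abs_coord_le_supNorm x i)
  rcases eq_or_ne j i with rfl | hj
  · exact le_rfl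
  · exact (h j hj).le

/-! ### Second moments on the dominance sets -/

/-- The mixed moment of the coordinates `j`, `k` on the dominance set of `i`. -/
noncomputable def topMoment (ν : Measure (Sph K)) (i j k : Fin K) : ℝ :=
  ∫ x, (topSet i).indicator (fun x => x.1 j * x.1 k) x ∂ν

theorem measurable_topSet_indicator (i j k : Fin K) :
    Measurable ((topSet i).indicator fun x : Sph K => x.1 j * x.1 k) :=
  ((continuous_coord j).mul (continuous_coord k)).measurable.indicator (measurableSet_topSet i)

theorem integrable_of_continuous [IsFiniteMeasure ν] {f : Sph K → ℝ} (hf : Continuous f) :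
    Integrable f ν := by
  obtain ⟨C, hC⟩ := isCompact_univ.exists_bound_of_continuousOn hf.continuousOn
  exact Integrable.of_bound hf.aestronglyMeasurable C
    (Filter.Eventually.of_forall fun x => hC x trivial)

theorem integrable_topSet_indicator [IsFiniteMeasure ν] (i : Fin K) {f : Sph K → ℝ}
    (hf : Continuous f) : Integrable ((topSet i).indicator f) ν :=
  (integrable_of_continuous hf).indicator (measurableSet_topSet i)

/-- Flipping the sign of `x_j` alone preserves `ν` and the dominance set, but negates the integrand.
-/
theorem topMoment_of_ne (h : IsSymmetric ν) (i : Fin K) {j k : Fin K} (hjk : j ≠ k) :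
    topMoment ν i j k = 0 := by
  have h1 := h.integral_signFlip (Function.update 1 j (-1)) (measurable_topSet_indicator i j k)
  have h2 : ∀ x : Sph K, (topSet i).indicator (fun x : Sph K => x.1 j * x.1 k)
      (signFlip (Function.update 1 j (-1)) x) =
      -(topSet i).indicator (fun x : Sph K => x.1 j * x.1 k) x := by
    intro x
    by_cases hx : x ∈ topSet i
    · rw [Set.indicator_of_mem hx, Set.indicator_of_mem ((signFlip_mem_topSet _ _ _).2 hx)]
      simp [signFlip_apply, Function.update_of_ne hjk.symm]
    · rw [Set.indicator_of_notMem hx,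
        Set.indicator_of_notMem (fun h => hx ((signFlip_mem_topSet _ _ _).1 h)), neg_zero]
  simp only [h2, integral_neg] at h1
  unfold topMoment
  linarith

theorem topMoment_perm (h : IsSymmetric ν) (p : Equiv.Perm (Fin K)) (i j k : Fin K) :
    topMoment ν (p i) (p j) (p k) = topMoment ν i j k := by
  unfold topMoment
  rw [← h.integral_permute p (measurable_topSet_indicator i j k)]
  congr 1
  ext x
  by_cases hx : x ∈ topSet (p i)
  · rw [Set.indicator_of_mem hx, Set.indicator_of_mem ((permute_mem_topSet _ _ _).2 hx)]
    rfl
  · rw [Set.indicator_of_notMem hx,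
      Set.indicator_of_notMem (fun h => hx ((permute_mem_topSet _ _ _).1 h))]

theorem topMoment_diag_eq (h : IsSymmetric ν) (i i' : Fin K) :
    topMoment ν i i i = topMoment ν i' i' i' := by
  simpa using (topMoment_perm h (Equiv.swap i i') i i i).symm

theorem topMoment_offDiag_eq (h : IsSymmetric ν) {i j i' j' : Fin K} (hij : j ≠ i)
    (hij' : j' ≠ i') : topMoment ν i j j = topMoment ν i' j' j' := by
  have h1 := topMoment_perm h (Equiv.swap i i') i j j
  rw [Equiv.swap_apply_left] at h1
  have hne : Equiv.swap i i' j ≠ i' := fun e =>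
    hij ((Equiv.swap i i').injective (e.trans (Equiv.swap_apply_left i i').symm))
  -- The second transposition carries the image of `j` to `j'` and fixes `i'`, because neither index
  -- equals `i'`.
  have h2 := topMoment_perm h (Equiv.swap (Equiv.swap i i' j) j') i' (Equiv.swap i i' j)
    (Equiv.swap i i' j)
  rw [Equiv.swap_apply_left, Equiv.swap_apply_of_ne_of_ne hne.symm hij'.symm] at h2
  rw [← h1, ← h2]

theorem exists_topMoment (h : IsSymmetric ν) : ∃ a g : ℝ,
    (∀ i, topMoment ν i i i = a) ∧ ∀ i j, j ≠ i → topMoment ν i j j = g := by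
  have ha : ∃ a, ∀ i, topMoment ν i i i = a := by
    rcases isEmpty_or_nonempty (Fin K) with he | ⟨⟨i⟩⟩
    · exact ⟨0, fun i => he.elim i⟩
    · exact ⟨_, fun i' => topMoment_diag_eq h i' i⟩
  have hg : ∃ g, ∀ i j, j ≠ i → topMoment ν i j j = g := by
    by_cases he : ∃ i j : Fin K, j ≠ i
    · obtain ⟨i, j, hij⟩ := he
      exact ⟨_, fun i' j' hij' => topMoment_offDiag_eq h hij' hij⟩
    · exact ⟨0, fun i j hij => (he ⟨i, j, hij⟩).elim⟩
  obtain ⟨a, ha⟩ := ha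
  obtain ⟨g, hg⟩ := hg
  exact ⟨a, g, ha, hg⟩

/-- The gap `𝔼 c₁² - (1 - 𝔼 c₁²) / (K - 1)`. -/
noncomputable def momentGap (ν : Measure (Sph K)) : ℝ :=
  meanSupSq ν - (1 - meanSupSq ν) / ((K : ℝ) - 1)

theorem meanSupSq_eq_sum [IsProbabilityMeasure ν] (hT : ∀ᵐ x ∂ν, ∃ i, x ∈ topSet i) :
    meanSupSq ν = ∑ i, topMoment ν i i i := by
  unfold topMoment
  rw [← integral_finsetSum]
  · refine integral_congr_ae ?_
    filter_upwards [hT] with x hx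
    obtain ⟨i, hi⟩ := hx
    rw [sum_indicator_topSet hi]
    change supNorm x ^ 2 = _
    rw [supNorm_eq_of_mem_topSet hi, sq_abs, sq]
  · exact fun i _ => integrable_topSet_indicator i (by fun_prop)

theorem sum_topMoment [IsProbabilityMeasure ν] (hT : ∀ᵐ x ∂ν, ∃ i, x ∈ topSet i) :
    ∑ i, ∑ j, topMoment ν i j j = 1 := by
  unfold topMoment
  have : ∀ i : Fin K, ∑ j, ∫ x, (topSet i).indicator (fun x => x.1 j * x.1 j) x ∂ν =
      ∫ x, (topSet i).indicator (fun _ => (1 : ℝ)) x ∂ν := by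
    intro i
    rw [← integral_finsetSum]
    · congr 1
      ext x
      by_cases hx : x ∈ topSet i
      · simp only [Set.indicator_of_mem hx]
        simpa [sq] using sum_sq_coord x
      · simp [hx]
    · exact fun j _ => integrable_topSet_indicator i (by fun_prop)
  simp only [this]
  rw [← integral_finsetSum]
  · have h1 : ∫ x, ∑ i, (topSet i).indicator (fun _ => (1 : ℝ)) x ∂ν = ∫ _, (1 : ℝ) ∂ν := by
      refine integral_congr_ae ?_
      filter_upwards [hT] with x hx
      obtain ⟨i, hi⟩ := hx
      exact sum_indicator_topSet hi fun _ _ => 1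
    rw [h1]; simp
  · exact fun i _ => integrable_topSet_indicator i continuous_const

theorem meanSupSq_le_one [IsProbabilityMeasure ν] : meanSupSq ν ≤ 1 := by
  have h : meanSupSq ν ≤ ∫ _, (1 : ℝ) ∂ν := by
    refine integral_mono (integrable_of_continuous (continuous_supNorm.pow 2))
      (integrable_const _) fun x => ?_
    exact pow_le_one₀ (supNorm_nonneg x) (supNorm_le_one x)
  simpa using h

theorem momentGap_le_one [IsProbabilityMeasure ν] (hK : 0 < K) : momentGap ν ≤ 1 := by
  have h := meanSupSq_le_one (ν := ν)
  have hK' : (1 : ℝ) ≤ K := by exact_mod_cast hK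
  have : 0 ≤ (1 - meanSupSq ν) / ((K : ℝ) - 1) := div_nonneg (by linarith) (by linarith)
  unfold momentGap
  linarith

/-- The largest coordinates give `meanSupSq ν = K a`, and the unit norm gives `1 = K (a + (K - 1)
g)`; eliminate `g`. -/
theorem exists_topMoment_gap [IsProbabilityMeasure ν] (h : IsSymmetric ν) (hK : 0 < K)
    (hT : ∀ᵐ x ∂ν, ∃ i, x ∈ topSet i) : ∃ a g : ℝ,
    (∀ i, topMoment ν i i i = a) ∧ (∀ i j, j ≠ i → topMoment ν i j j = g) ∧
      a - g = momentGap ν / K := by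
  obtain ⟨a, g, ha, hg⟩ := exists_topMoment h
  have h1 : meanSupSq ν = K * a := by simp [meanSupSq_eq_sum hT, ha]
  rcases Nat.eq_or_lt_of_le (Nat.succ_le_of_lt hK) with h1K | h1K
  -- For `K = 1` there are no off-diagonal moments; `g = 0` matches the convention that the fraction
  -- with denominator `K - 1 = 0` vanishes.
  · refine ⟨a, 0, ha, fun i j hij => ?_, ?_⟩
    · subst h1K
      exact (hij (Subsingleton.elim _ _)).elim
    · unfold momentGap
      rw [h1, ← h1K]
      simp
  · refine ⟨a, g, ha, hg, ?_⟩
    have h2 := sum_topMoment hT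
    have h3 : ∀ i : Fin K, ∑ j, topMoment ν i j j = a + (K - 1) * g := by
      intro i
      rw [← Finset.add_sum_erase _ _ (Finset.mem_univ i), ha,
        Finset.sum_congr rfl fun j hj => hg i j (Finset.ne_of_mem_erase hj)]
      simp [Nat.cast_sub hK]
    simp only [h3, Finset.sum_const, Finset.card_univ, Fintype.card_fin, nsmul_eq_mul] at h2
    have hK1 : (1 : ℝ) < K := by exact_mod_cast h1K
    have hK2 : (K : ℝ) - 1 ≠ 0 := by linarith
    have hK3 : (K : ℝ) ≠ 0 := by linarith
    unfold momentGap
    rw [h1]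
    field_simp
    linear_combination -h2

/-- For `K ≥ 2` the gap equals `(K · meanSupSq ν - 1) / (K - 1)`, and strict dominance forces `1 = ∑
x_k² < K ‖x‖_∞²` almost surely. -/
theorem momentGap_pos [IsProbabilityMeasure ν] (hK : 0 < K)
    (hT : ∀ᵐ x ∂ν, ∃ i, x ∈ topSet i) : 0 < momentGap ν := by
  have hi : Integrable (fun x : Sph K => K * supNorm x ^ 2 - 1) ν :=
    integrable_of_continuous (by have := continuous_supNorm (K := K); fun_prop)
  have hv : ∫ x, (K * supNorm x ^ 2 - 1) ∂ν = K * meanSupSq ν - 1 := by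
    rw [integral_sub, integral_const_mul]
    · simp only [integral_const, probReal_univ, smul_eq_mul, mul_one]
      rfl
    · exact (integrable_of_continuous (continuous_supNorm.pow 2)).const_mul _
    · exact integrable_const _
  rcases Nat.eq_or_lt_of_le (Nat.succ_le_of_lt hK) with h1K | h1K
  · have h1 := meanSupSq_eq_sum hT
    have h2 := sum_topMoment hT
    subst h1K
    simp at h1 h2
    simp [momentGap, h1, h2]
  · have hpos : ∀ᵐ x ∂ν, 0 < K * supNorm x ^ 2 - 1 := by
      filter_upwards [hT] with x hx
      obtain ⟨i, hi⟩ := hx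
      obtain ⟨j, hj⟩ : ∃ j, j ≠ i := by
        have : Nontrivial (Fin K) := Fin.nontrivial_iff_two_le.2 h1K
        exact exists_ne i
      have hlt : ∑ k, (x.1 k) ^ 2 < ∑ _k : Fin K, supNorm x ^ 2 := by
        refine Finset.sum_lt_sum (fun k _ => ?_) ⟨j, Finset.mem_univ _, ?_⟩
        · rw [← sq_abs]
          exact pow_le_pow_left₀ (abs_nonneg _) (abs_coord_le_supNorm x k) 2
        · rw [← sq_abs, supNorm_eq_of_mem_topSet hi]
          exact pow_lt_pow_left₀ (hi j hj) (abs_nonneg _) two_ne_zero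
      rw [sum_sq_coord] at hlt
      simp at hlt
      linarith
    have h := (integral_pos_iff_support_of_nonneg_ae
      (hpos.mono fun x hx => hx.le) hi).2 (by
        have : ν (Function.support fun x : Sph K => K * supNorm x ^ 2 - 1) = 1 := by
          rw [← prob_compl_eq_zero_iff
            (measurableSet_support (by have := continuous_supNorm (K := K); fun_prop))]
          exact hpos.mono fun x hx => by simpa using hx.ne'
        rw [this]; exact one_pos)
    rw [hv] at h
    have hK1 : (1 : ℝ) < K := by exact_mod_cast h1K
    have : momentGap ν = (K * meanSupSq ν - 1) / (K - 1) := by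
      have hK2 : (K : ℝ) - 1 ≠ 0 := by linarith
      unfold momentGap
      field_simp
      ring
    rw [this]
    exact div_pos h (by linarith)

/-! ### Tight frames -/

theorem inner_synth (Φ : Fin K → E d) (v : E d) (x : E K) :
    inner ℝ v (synth Φ x) = ∑ j, x j * inner ℝ v (Φ j) := by
  simp [synth, inner_sum, inner_smul_right]

theorem norm_synth_sq_le {Φ : Fin K → E d} {A : ℝ} (hA0 : 0 ≤ A)
    (hA : ∀ v : E d, ∑ i, (inner ℝ (Φ i) v) ^ 2 = A * ‖v‖ ^ 2) (x : Sph K) :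
    ‖synth Φ x.1‖ ^ 2 ≤ A := by
  set y := synth Φ x.1 with hy
  have h1 : ‖y‖ ^ 2 = ∑ j, x.1 j * inner ℝ (Φ j) y := by
    rw [← real_inner_self_eq_norm_sq]
    conv_lhs => rw [hy, inner_synth, ← hy]
    simp [real_inner_comm]
  have h2 := Finset.sum_mul_sq_le_sq_mul_sq Finset.univ x.1 fun j => (inner ℝ (Φ j) y : ℝ)
  rw [← h1, sum_sq_coord, hA, one_mul] at h2
  rcases eq_or_ne y 0 with h0 | h0
  · simpa [h0] using hA0
  · have hpos : 0 < ‖y‖ ^ 2 := by positivity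
    nlinarith

/-- Summing the frame identity over an orthonormal basis gives `A d = K`; testing it on one atom
gives `A ≥ 1`. -/
theorem tightFrame_const {Φ : Fin K → E d} {A : ℝ} (hΦ : Φ ∈ dictionaries d K) (hK : 0 < K)
    (hA : ∀ v : E d, ∑ i, (inner ℝ (Φ i) v) ^ 2 = A * ‖v‖ ^ 2) : A = K / d ∧ 1 ≤ A := by
  have h1 : 1 ≤ A := by
    have h := hA (Φ ⟨0, hK⟩)
    rw [hΦ] at h
    have h2 := Finset.single_le_sum (f := fun i => (inner ℝ (Φ i) (Φ ⟨0, hK⟩) : ℝ) ^ 2)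
      (fun i _ => sq_nonneg _) (Finset.mem_univ ⟨0, hK⟩)
    rw [h, real_inner_self_eq_norm_sq, hΦ] at h2
    simpa using h2
  refine ⟨?_, h1⟩
  have h2 : ∑ i, ∑ k, (inner ℝ (Φ i) (EuclideanSpace.basisFun (Fin d) ℝ k)) ^ 2 = (K : ℝ) := by
    simp only [OrthonormalBasis.sum_sq_inner_left]
    simp [show ∀ i, ‖Φ i‖ = 1 from hΦ]
  rw [Finset.sum_comm] at h2
  simp only [hA] at h2
  simp at h2
  have hK' : (0 : ℝ) < K := by exact_mod_cast hK
  have hd : (d : ℝ) ≠ 0 := by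
    intro h
    rw [h] at h2
    linarith
  rw [← h2]
  field_simp

/-! ### The contribution of the dominant atom -/

theorem continuous_synth (Φ : Fin K → E d) : Continuous fun x : Sph K => synth Φ x.1 := by
  unfold synth
  fun_prop

theorem continuous_inner_synth (Φ : Fin K → E d) (v : E d) :
    Continuous fun x : Sph K => (inner ℝ v (synth Φ x.1) : ℝ) :=
  continuous_const.inner (continuous_synth Φ)

/-- The squared response of the atom whose index carries the dominant coefficient. -/
noncomputable def lead (Φ Ψ : Fin K → E d) (x : Sph K) : ℝ :=
  ∑ i, (topSet i).indicator (fun x => (inner ℝ (Ψ i) (synth Φ x.1) : ℝ) ^ 2) x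

theorem integrable_lead [IsFiniteMeasure ν] (Φ Ψ : Fin K → E d) : Integrable (lead Φ Ψ) ν := by
  unfold lead
  exact integrable_finsetSum _ fun i _ =>
    integrable_topSet_indicator i ((continuous_inner_synth Φ (Ψ i)).pow 2)

theorem lead_of_mem {Φ Ψ : Fin K → E d} {x : Sph K} {i : Fin K} (hi : x ∈ topSet i) :
    lead Φ Ψ x = (inner ℝ (Ψ i) (synth Φ x.1) : ℝ) ^ 2 :=
  sum_indicator_topSet hi fun i x => (inner ℝ (Ψ i) (synth Φ x.1) : ℝ) ^ 2

theorem integral_topSet_inner_sq [IsProbabilityMeasure ν] (h : IsSymmetric ν) (Φ : Fin K → E d)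
    (v : E d) (i : Fin K) :
    ∫ x, (topSet i).indicator (fun x => (inner ℝ v (synth Φ x.1) : ℝ) ^ 2) x ∂ν =
      ∑ j, topMoment ν i j j * (inner ℝ v (Φ j)) ^ 2 := by
  have h1 : ∀ x : Sph K, (topSet i).indicator (fun x => (inner ℝ v (synth Φ x.1) : ℝ) ^ 2) x =
      ∑ j, ∑ k, (inner ℝ v (Φ j) * inner ℝ v (Φ k)) *
        (topSet i).indicator (fun x => x.1 j * x.1 k) x := by
    intro x
    by_cases hx : x ∈ topSet i
    · simp only [Set.indicator_of_mem hx]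
      rw [inner_synth, sq, Finset.sum_mul_sum]
      exact Finset.sum_congr rfl fun j _ => Finset.sum_congr rfl fun k _ => by ring
    · simp [hx]
  simp only [h1]
  have hint : ∀ j k : Fin K, Integrable (fun x : Sph K => (inner ℝ v (Φ j) * inner ℝ v (Φ k)) *
        (topSet i).indicator (fun x => x.1 j * x.1 k) x) ν := fun j k =>
    (integrable_topSet_indicator i (by fun_prop)).const_mul _
  rw [integral_finsetSum _ fun j _ => integrable_finsetSum _ fun k _ => hint j k]
  refine Finset.sum_congr rfl fun j _ => ?_
  rw [integral_finsetSum _ fun k _ => hint j k, Finset.sum_eq_single j]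
  · rw [integral_const_mul]
    unfold topMoment
    ring
  · intro k _ hk
    rw [integral_const_mul]
    change _ * topMoment ν i j k = 0
    rw [topMoment_of_ne h i hk.symm, mul_zero]
  · simp

theorem integral_lead_sub [IsProbabilityMeasure ν] (h : IsSymmetric ν) (hK : 0 < K)
    (hT : ∀ᵐ x ∂ν, ∃ i, x ∈ topSet i) {Φ Ψ : Fin K → E d} {A : ℝ}
    (hΦ : Φ ∈ dictionaries d K) (hΨ : Ψ ∈ dictionaries d K)
    (hA : ∀ v : E d, ∑ i, (inner ℝ (Φ i) v) ^ 2 = A * ‖v‖ ^ 2) :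
    ∫ x, lead Φ Φ x ∂ν - ∫ x, lead Φ Ψ x ∂ν =
      momentGap ν / K * ∑ i, (1 - (inner ℝ (Ψ i) (Φ i)) ^ 2) := by
  obtain ⟨a, g, ha, hg, hgap⟩ := exists_topMoment_gap h hK hT
  have key : ∀ Θ ∈ dictionaries d K, ∫ x, lead Φ Θ x ∂ν =
      ∑ i, (g * A + (a - g) * (inner ℝ (Θ i) (Φ i)) ^ 2) := by
    intro Θ hΘ
    unfold lead
    rw [integral_finsetSum]
    swap
    · exact fun i _ => integrable_topSet_indicator i ((continuous_inner_synth Φ (Θ i)).pow 2)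
    refine Finset.sum_congr rfl fun i _ => ?_
    rw [integral_topSet_inner_sq h, ← Finset.add_sum_erase _ _ (Finset.mem_univ i), ha,
      Finset.sum_congr rfl fun j hj => by rw [hg i j (Finset.ne_of_mem_erase hj)],
      ← Finset.mul_sum]
    have h2 := hA (Θ i)
    simp only [real_inner_comm (Θ i)] at h2
    rw [hΘ, ← Finset.add_sum_erase _ _ (Finset.mem_univ i)] at h2
    linear_combination g * h2
  rw [key Φ hΦ, key Ψ hΨ, ← hgap, ← Finset.sum_sub_distrib, Finset.mul_sum]
  refine Finset.sum_congr rfl fun i _ => ?_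
  rw [real_inner_self_eq_norm_sq, hΦ]
  ring

theorem continuous_analysis_sq (Φ Ψ : Fin K → E d) :
    Continuous fun x : Sph K => ‖analysis Ψ (synth Φ x.1)‖ ^ 2 :=
  (continuous_pi fun i => continuous_inner_synth Φ (Ψ i)).norm.pow 2

theorem inner_sq_le_analysis_sq (Φ Ψ : Fin K → E d) (x : Sph K) (i : Fin K) :
    (inner ℝ (Ψ i) (synth Φ x.1) : ℝ) ^ 2 ≤ ‖analysis Ψ (synth Φ x.1)‖ ^ 2 := by
  rw [← sq_abs]
  exact pow_le_pow_left₀ (abs_nonneg _) (norm_le_pi_norm (analysis Ψ (synth Φ x.1)) i) 2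

theorem integral_lead_le_criterion [IsProbabilityMeasure ν]
    (hT : ∀ᵐ x ∂ν, ∃ i, x ∈ topSet i) (Φ Ψ : Fin K → E d) :
    ∫ x, lead Φ Ψ x ∂ν ≤ criterion ν Φ Ψ := by
  refine integral_mono_ae (integrable_lead Φ Ψ)
    (integrable_of_continuous (continuous_analysis_sq Φ Ψ)) ?_
  filter_upwards [hT] with x hx
  obtain ⟨i, hi⟩ := hx
  rw [lead_of_mem hi]
  exact inner_sq_le_analysis_sq Φ Ψ x i

theorem analysis_sq_le {Φ Ψ : Fin K → E d} {A : ℝ} (hΨ : Ψ ∈ dictionaries d K) (hA0 : 0 ≤ A)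
    (hA : ∀ v : E d, ∑ i, (inner ℝ (Φ i) v) ^ 2 = A * ‖v‖ ^ 2) (x : Sph K) :
    ‖analysis Ψ (synth Φ x.1)‖ ^ 2 ≤ A := by
  refine le_trans (pow_le_pow_left₀ (norm_nonneg _) ?_ 2) (norm_synth_sq_le hA0 hA x)
  refine (pi_norm_le_iff_of_nonneg (norm_nonneg _)).2 fun i => ?_
  refine (norm_inner_le_norm _ _).trans ?_
  rw [hΨ, one_mul]

/-- The event that the perturbation `w` responds to the signal more than `m ‖x‖_∞`. -/
def deviation (Φ : Fin K → E d) (w : E d) (m : ℝ) : Set (Sph K) :=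
  {x | m * supNorm x < |inner ℝ w (synth Φ x.1)|}

theorem measurableSet_deviation (Φ : Fin K → E d) (w : E d) (m : ℝ) :
    MeasurableSet (deviation Φ w m) :=
  (isOpen_lt (continuous_const.mul continuous_supNorm)
    (continuous_inner_synth Φ w).abs).measurableSet

/-- The margin `2 m ‖x‖_∞` absorbs one loss of `m ‖x‖_∞` by the leading atom and one equal gain by a
competitor. -/
theorem analysis_sq_le_lead {Φ Ψ : Fin K → E d} {x : Sph K} {i : Fin K} {m : ℝ}
    (hi : x ∈ topSet i)
    (hsep : ∀ j, j ≠ i → |inner ℝ (Φ j) (synth Φ x.1)| + 2 * (m * supNorm x) ≤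
      |inner ℝ (Φ i) (synth Φ x.1)|)
    (hdev : ∀ j, x ∉ deviation Φ (Ψ j - Φ j) m) :
    ‖analysis Ψ (synth Φ x.1)‖ ^ 2 ≤ lead Φ Ψ x := by
  rw [lead_of_mem hi, ← sq_abs (inner ℝ (Ψ i) _)]
  refine pow_le_pow_left₀ (norm_nonneg _) ?_ 2
  refine (pi_norm_le_iff_of_nonneg (abs_nonneg _)).2 fun j => ?_
  rcases eq_or_ne j i with rfl | hj
  · exact le_rfl
  · have h1 := hsep j hj
    have h2 : ∀ k, |(inner ℝ (Ψ k) (synth Φ x.1) : ℝ) - inner ℝ (Φ k) (synth Φ x.1)| ≤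
        m * supNorm x := fun k => by
      rw [← inner_sub_left]
      exact not_lt.1 (hdev k)
    have h3 := abs_sub_abs_le_abs_sub (inner ℝ (Ψ j) (synth Φ x.1) : ℝ)
      (inner ℝ (Φ j) (synth Φ x.1))
    have h4 := abs_sub_abs_le_abs_sub (inner ℝ (Φ i) (synth Φ x.1) : ℝ)
      (inner ℝ (Ψ i) (synth Φ x.1))
    rw [abs_sub_comm] at h4
    have h5 := h2 i
    have h6 := h2 j
    change |(inner ℝ (Ψ j) (synth Φ x.1) : ℝ)| ≤ _
    linarith

/-- On `N` and on the deviation events the integrand is bounded by `A`, the upper bound for `‖Φ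
x‖²`; elsewhere `analysis_sq_le_lead` applies. -/
theorem criterion_le_lead [IsProbabilityMeasure ν] {Φ Ψ : Fin K → E d} {A m : ℝ}
    (hΨ : Ψ ∈ dictionaries d K) (hA0 : 0 ≤ A)
    (hA : ∀ v : E d, ∑ i, (inner ℝ (Φ i) v) ^ 2 = A * ‖v‖ ^ 2) {N : Set (Sph K)}
    (hsep : ∀ᵐ x ∂ν, x ∈ N ∨ ∃ i, x ∈ topSet i ∧ ∀ j, j ≠ i →
      |inner ℝ (Φ j) (synth Φ x.1)| + 2 * (m * supNorm x) ≤ |inner ℝ (Φ i) (synth Φ x.1)|) :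
    criterion ν Φ Ψ ≤ ∫ x, lead Φ Ψ x ∂ν +
      (A * ν.real N + ∑ j, A * ν.real (deviation Φ (Ψ j - Φ j) m)) := by
  -- No measurability of `N` is assumed, so its indicator is replaced by that of a measurable hull
  -- of equal measure.
  set N' := toMeasurable ν N with hN'
  have hNm : MeasurableSet N' := measurableSet_toMeasurable ν N
  have hreal : ν.real N = ν.real N' := by simp [Measure.real, hN', measure_toMeasurable]
  have hind : ∀ S : Set (Sph K), MeasurableSet S →
      Integrable (S.indicator fun _ => A) ν ∧ ∫ x, S.indicator (fun _ => A) x ∂ν = A * ν.real S :=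
    fun S hS => ⟨(integrable_const A).indicator hS, by
      rw [integral_indicator_const _ hS, smul_eq_mul, mul_comm]⟩
  have hdev := fun j => hind _ (measurableSet_deviation Φ (Ψ j - Φ j) m)
  have hI1 := integrable_finsetSum Finset.univ fun j _ => (hdev j).1
  have hI2 := (hind N' hNm).1.add hI1
  rw [hreal, ← (hind N' hNm).2, Finset.sum_congr rfl fun j _ => (hdev j).2.symm,
    ← integral_finsetSum _ fun j _ => (hdev j).1]
  have e1 := integral_add (hind N' hNm).1 hI1
  have e2 := integral_add (integrable_lead (ν := ν) Φ Ψ) hI2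
  simp only [Pi.add_apply] at e1 e2
  rw [← e1, ← e2]
  refine integral_mono_ae (integrable_of_continuous (continuous_analysis_sq Φ Ψ))
    ((integrable_lead Φ Ψ).add hI2) ?_
  have hn0 : ∀ S : Set (Sph K), ∀ x, 0 ≤ S.indicator (fun _ => A) x := fun S x =>
    Set.indicator_nonneg (fun _ _ => hA0) x
  filter_upwards [hsep] with x hx
  have hl0 : 0 ≤ lead Φ Ψ x := Finset.sum_nonneg fun i _ =>
    Set.indicator_nonneg (fun _ _ => sq_nonneg _) x
  have hs0 : 0 ≤ ∑ j, (deviation Φ (Ψ j - Φ j) m).indicator (fun _ => A) x :=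
    Finset.sum_nonneg fun j _ => hn0 _ x
  have hle := analysis_sq_le hΨ hA0 hA x
  by_cases hxN : x ∈ N'
  · have : N'.indicator (fun _ => A) x = A := Set.indicator_of_mem hxN _
    linarith
  · by_cases hxd : ∃ j, x ∈ deviation Φ (Ψ j - Φ j) m
    · obtain ⟨j, hj⟩ := hxd
      have h1 := Finset.single_le_sum
        (f := fun j => (deviation Φ (Ψ j - Φ j) m).indicator (fun _ => A) x)
        (fun j _ => hn0 _ x) (Finset.mem_univ j)
      have h2 : (deviation Φ (Ψ j - Φ j) m).indicator (fun _ => A) x = A :=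
        Set.indicator_of_mem hj _
      have h3 := hn0 N' x
      linarith
    · push Not at hxd
      rcases hx with hx | ⟨i, hi, hs⟩
      · exact (hxN (subset_toMeasurable ν N hx)).elim
      · have h1 := analysis_sq_le_lead hi hs hxd
        have h3 := hn0 N' x
        linarith

/-! ### Concentration over random signs -/

/-- The sum over signs factors into terms `2 cosh y_k ≤ 2 exp (y_k² / 2)`. -/
theorem sum_exp_signs_le (y : Fin K → ℝ) :
    ∑ σ : Fin K → ℤˣ, Real.exp (∑ k, ((σ k : ℤ) : ℝ) * y k) ≤
      2 ^ K * Real.exp ((∑ k, y k ^ 2) / 2) := by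
  have h1 : ∑ σ : Fin K → ℤˣ, Real.exp (∑ k, ((σ k : ℤ) : ℝ) * y k) =
      ∏ k, ∑ u : ℤˣ, Real.exp (((u : ℤ) : ℝ) * y k) := by
    rw [Finset.prod_univ_sum, Fintype.piFinset_univ]
    exact Finset.sum_congr rfl fun σ _ => Real.exp_sum _ _
  have h2 : ∀ k, ∑ u : ℤˣ, Real.exp (((u : ℤ) : ℝ) * y k) = 2 * Real.cosh (y k) := by
    intro k
    rw [show (Finset.univ : Finset ℤˣ) = {1, -1} from rfl, Finset.sum_pair (by decide),
      Real.cosh_eq]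
    simp
    ring
  have h3 : (2 : ℝ) ^ K * Real.exp ((∑ k, y k ^ 2) / 2) =
      ∏ k, 2 * Real.exp (y k ^ 2 / 2) := by
    rw [Finset.prod_mul_distrib, ← Real.exp_sum, Finset.sum_div]
    simp
  rw [h1, h3]
  refine Finset.prod_le_prod (fun k _ => Finset.sum_nonneg fun _ _ => (Real.exp_pos _).le)
    fun k _ => ?_
  rw [h2]
  exact mul_le_mul_of_nonneg_left (Real.cosh_le_exp_half_sq _) zero_le_two

/-- The response of `w` to the signal, relative to the largest coefficient. -/
noncomputable def relResponse (Φ : Fin K → E d) (w : E d) (x : Sph K) : ℝ :=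
  inner ℝ w (synth Φ x.1) / supNorm x

theorem continuous_relResponse (Φ : Fin K → E d) (w : E d) : Continuous (relResponse Φ w) :=
  (continuous_inner_synth Φ w).div continuous_supNorm fun x => (supNorm_pos x).ne'

/-- Sign invariance lets the moment generating function be averaged over all sign flips, which leave
`supNorm` unchanged. After normalisation every `|x_k| / ‖x‖_∞` is at most `1`, so the variance proxy
is at most `∑ ⟨w, φ_k⟩² = A ‖w‖²`. -/
theorem hasSubgaussianMGF_relResponse [IsProbabilityMeasure ν] (h : IsSymmetric ν)
    {Φ : Fin K → E d} {A : ℝ} (hA0 : 0 ≤ A)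
    (hA : ∀ v : E d, ∑ i, (inner ℝ (Φ i) v) ^ 2 = A * ‖v‖ ^ 2) (w : E d) :
    ProbabilityTheory.HasSubgaussianMGF (relResponse Φ w) (A * ‖w‖ ^ 2).toNNReal ν := by
  have hc : ∀ t, Continuous fun x => Real.exp (t * relResponse Φ w x) := fun t => by
    have := continuous_relResponse Φ w
    fun_prop
  refine ⟨fun t => integrable_of_continuous (hc t), fun t => ?_⟩
  rw [Real.coe_toNNReal _ (by positivity)]
  have hflip : ∀ (σ : Fin K → ℤˣ) (x : Sph K), t * relResponse Φ w (signFlip σ x) =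
      ∑ k, ((σ k : ℤ) : ℝ) * (t * (x.1 k / supNorm x) * inner ℝ w (Φ k)) := by
    intro σ x
    rw [relResponse, inner_synth, supNorm_signFlip, Finset.sum_div, Finset.mul_sum]
    refine Finset.sum_congr rfl fun k _ => ?_
    rw [signFlip_apply]
    ring
  have hvar : ∀ x : Sph K, ∑ k, (t * (x.1 k / supNorm x) * inner ℝ w (Φ k)) ^ 2 ≤
      A * ‖w‖ ^ 2 * t ^ 2 := by
    intro x
    rw [← hA w, Finset.sum_mul]
    refine Finset.sum_le_sum fun k _ => ?_
    have h1 : (x.1 k / supNorm x) ^ 2 ≤ 1 := by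
      rw [sq_le_one_iff_abs_le_one, abs_div, abs_of_pos (supNorm_pos x)]
      exact (div_le_one (supNorm_pos x)).2 (abs_coord_le_supNorm x k)
    rw [real_inner_comm, mul_pow, mul_pow, mul_comm]
    exact mul_le_mul_of_nonneg_left
      (mul_le_of_le_one_right (sq_nonneg t) h1) (sq_nonneg _)
  have h1 : ∑ σ : Fin K → ℤˣ, ∫ x, Real.exp (t * relResponse Φ w (signFlip σ x)) ∂ν =
      2 ^ K * ∫ x, Real.exp (t * relResponse Φ w x) ∂ν := by
    rw [Finset.sum_congr rfl fun σ _ => h.integral_signFlip σ (hc t).measurable]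
    simp
  have hint : ∀ σ : Fin K → ℤˣ,
      Integrable (fun x => Real.exp (t * relResponse Φ w (signFlip σ x))) ν := fun σ =>
    integrable_of_continuous ((hc t).comp (continuous_signFlip σ))
  rw [← integral_finsetSum _ fun σ _ => hint σ] at h1
  have h2 : ∫ x, ∑ σ : Fin K → ℤˣ, Real.exp (t * relResponse Φ w (signFlip σ x)) ∂ν ≤
      ∫ _, 2 ^ K * Real.exp (A * ‖w‖ ^ 2 * t ^ 2 / 2) ∂ν := by
    refine integral_mono (integrable_finsetSum _ fun σ _ => hint σ) (integrable_const _)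
      fun x => ?_
    simp only [hflip]
    refine (sum_exp_signs_le _).trans (mul_le_mul_of_nonneg_left (Real.exp_le_exp.2 ?_)
      (by positivity))
    linarith [hvar x]
  rw [h1] at h2
  simp only [integral_const, probReal_univ, smul_eq_mul, one_mul] at h2
  exact le_of_mul_le_mul_left h2 (by positivity)

theorem measureReal_deviation_le [IsProbabilityMeasure ν] (h : IsSymmetric ν)
    {Φ : Fin K → E d} {A m : ℝ} (hA0 : 0 ≤ A) (hm : 0 ≤ m)
    (hA : ∀ v : E d, ∑ i, (inner ℝ (Φ i) v) ^ 2 = A * ‖v‖ ^ 2) (w : E d) :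
    ν.real (deviation Φ w m) ≤ 2 * Real.exp (-(m ^ 2 / (2 * (A * ‖w‖ ^ 2)))) := by
  have hsub := hasSubgaussianMGF_relResponse h hA0 hA w
  have h1 := hsub.measure_ge_le hm
  have h2 := hsub.neg.measure_ge_le hm
  rw [Real.coe_toNNReal _ (by positivity), neg_div] at h1 h2
  have h3 : deviation Φ w m ⊆ {x | m ≤ relResponse Φ w x} ∪ {x | m ≤ (-relResponse Φ w) x} := by
    intro x hx
    rcases lt_abs.1 (show m * supNorm x < |inner ℝ w (synth Φ x.1)| from hx) with h | h
    · exact Or.inl ((le_div_iff₀ (supNorm_pos x)).2 h.le)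
    · refine Or.inr ?_
      change m ≤ -(_ / _)
      rw [← neg_div]
      exact (le_div_iff₀ (supNorm_pos x)).2 h.le
  have h4 := (measureReal_mono (μ := ν) h3).trans (measureReal_union_le _ _)
  linarith

/-- Needed for unmoved atoms: at `w = 0` the exponent in the tail bound is a division by zero, and
the bound is only `2`. -/
theorem deviation_zero (Φ : Fin K → E d) {m : ℝ} (hm : 0 ≤ m) : deviation Φ 0 m = ∅ := by
  ext x
  simpa [deviation] using mul_nonneg hm (supNorm_nonneg x)

/-! ### The non-increasing rearrangement and the dominant coordinate -/

theorem exists_rearr_top (hK : 0 < K) (x : Sph K) :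
    ∃ i, |x.1 i| = c₁ x.1 ∧ ∀ j, j ≠ i → |x.1 j| ≤ c₂ x.1 := by
  obtain ⟨p, hp⟩ := exists_perm_rearr x.1
  refine ⟨p ⟨0, hK⟩, by rw [c₁, dif_pos hK, hp], fun j hj => ?_⟩
  have h1 : p.symm j ≠ ⟨0, hK⟩ := fun e => hj (by rw [← e]; simp)
  have h2 : 1 ≤ (p.symm j).1 := Nat.one_le_iff_ne_zero.2 fun e => h1 (Fin.ext e)
  have h3 : 1 < K := lt_of_le_of_lt h2 (p.symm j).2
  rw [c₂, dif_pos h3]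
  have h4 := rearr_antitone x.1 (show (⟨1, h3⟩ : Fin K) ≤ p.symm j from h2)
  rw [hp (p.symm j)] at h4
  simpa using h4

theorem c₂_nonneg (x : E K) : 0 ≤ c₂ x := by
  unfold c₂
  split_ifs
  · exact abs_nonneg _
  · exact le_rfl

theorem c₂_le_c₁ (hK : 0 < K) (x : E K) : c₂ x ≤ c₁ x := by
  rw [c₁, dif_pos hK]
  unfold c₂
  split_ifs with h
  · exact rearr_antitone x (Fin.mk_le_mk.2 zero_le_one)
  · exact abs_nonneg _

theorem c₁_eq_supNorm (hK : 0 < K) (x : Sph K) : c₁ x.1 = supNorm x := by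
  obtain ⟨i, hi, hj⟩ := exists_rearr_top hK x
  refine le_antisymm (hi ▸ abs_coord_le_supNorm x i)
    ((pi_norm_le_iff_of_nonneg (hi ▸ abs_nonneg _)).2 fun j => ?_)
  rcases eq_or_ne j i with rfl | hji
  · exact hi.le
  · exact (hj j hji).trans (c₂_le_c₁ hK _)

theorem sum_rearr (x : E K) : ∑ i, rearr x i = ∑ i, |x i| := by
  obtain ⟨p, hp⟩ := exists_perm_rearr x
  simp only [hp]
  exact Equiv.sum_comp p fun i => |x i|

theorem one_le_rearr (hK : 0 < K) (x : Sph K) :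
    1 ≤ supNorm x ^ 2 + (K - 1) * c₂ x.1 ^ 2 := by
  obtain ⟨i, hi, hj⟩ := exists_rearr_top hK x
  have h1 := sum_sq_coord x
  rw [← Finset.add_sum_erase _ _ (Finset.mem_univ i), ← sq_abs, hi, c₁_eq_supNorm hK] at h1
  have h := Finset.sum_le_card_nsmul (Finset.univ.erase i) (fun j => (x.1 j) ^ 2) (c₂ x.1 ^ 2)
    fun j hji => by
      rw [← sq_abs]
      exact pow_le_pow_left₀ (abs_nonneg _) (hj j (Finset.ne_of_mem_erase hji)) 2
  rw [Finset.card_erase_of_mem (Finset.mem_univ i), Finset.card_univ, Fintype.card_fin,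
    nsmul_eq_mul, Nat.cast_sub (Nat.succ_le_of_lt hK), Nat.cast_one] at h
  linarith

theorem exists_mem_topSet (hK : 0 < K) {x : Sph K} (h : c₂ x.1 < c₁ x.1) :
    ∃ i, x ∈ topSet i ∧ ∀ j, j ≠ i → |x.1 j| ≤ c₂ x.1 := by
  obtain ⟨i, hi, hj⟩ := exists_rearr_top hK x
  exact ⟨i, fun j hji => (hj j hji).trans_lt (hi ▸ h), hj⟩

/-! ### Coherence -/

theorem coherence_nonneg (Φ : Fin K → E d) : 0 ≤ coherence Φ :=
  Real.iSup_nonneg fun _ => abs_nonneg _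

theorem abs_inner_le_coherence (Φ : Fin K → E d) {i j : Fin K} (h : i ≠ j) :
    |inner ℝ (Φ i) (Φ j)| ≤ coherence Φ :=
  le_ciSup (f := fun p : {p : Fin K × Fin K // p.1 ≠ p.2} => |inner ℝ (Φ p.1.1) (Φ p.1.2)|)
    (Set.finite_range _).bddAbove ⟨(i, j), h⟩

theorem abs_inner_synth_sub_le {Φ : Fin K → E d} (hΦ : Φ ∈ dictionaries d K) (x : E K)
    (i : Fin K) :
    |inner ℝ (Φ i) (synth Φ x) - x i| ≤ coherence Φ * ∑ j, |x j| := by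
  rw [inner_synth, ← Finset.add_sum_erase _ _ (Finset.mem_univ i), real_inner_self_eq_norm_sq, hΦ,
    one_pow, mul_one, add_sub_cancel_left, Finset.mul_sum]
  refine (Finset.abs_sum_le_sum_abs _ _).trans ?_
  refine (Finset.sum_le_sum fun j hj => ?_).trans
    (Finset.sum_le_sum_of_subset_of_nonneg (Finset.erase_subset i _)
      fun j _ _ => mul_nonneg (coherence_nonneg Φ) (abs_nonneg _))
  rw [abs_mul, mul_comm]
  exact mul_le_mul_of_nonneg_right
    (abs_inner_le_coherence Φ (Finset.ne_of_mem_erase hj).symm) (abs_nonneg _)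

/-- Each response differs from its coefficient by at most `μ ‖x‖₁`, so the margin is at least `c₁ -
c₂ - 2 μ ‖x‖₁`. Decay bounds this below by `(1 - 2β)(c₁ + c₂)`, hence by `(1 - 2β) ‖x‖_∞`. -/
theorem separation_of_decaying {Φ : Fin K → E d} (hΦ : Φ ∈ dictionaries d K) (hK : 0 < K)
    {β : ℝ} (hβ : β < 1 / 2) {x : Sph K}
    (hx : (c₂ x.1 + coherence Φ * ∑ i, rearr x.1 i) / (c₂ x.1 + c₁ x.1) ≤ β) :
    ∃ i, x ∈ topSet i ∧ ∀ j, j ≠ i →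
      |inner ℝ (Φ j) (synth Φ x.1)| + 2 * ((1 - 2 * β) / 2 * supNorm x) ≤
        |inner ℝ (Φ i) (synth Φ x.1)| := by
  have h1 := supNorm_pos x
  have h2 := c₂_nonneg x.1
  rw [c₁_eq_supNorm hK, sum_rearr, div_le_iff₀ (by linarith)] at hx
  have h3 : 0 ≤ coherence Φ * ∑ i, |x.1 i| :=
    mul_nonneg (coherence_nonneg Φ) (Finset.sum_nonneg fun _ _ => abs_nonneg _)
  have h4 : 0 ≤ (1 - 2 * β) * (c₂ x.1) := mul_nonneg (by linarith) h2
  have h5 : 0 < (1 - 2 * β) * supNorm x := mul_pos (by linarith) h1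
  obtain ⟨i, hi, hj⟩ := exists_mem_topSet hK (x := x) (by rw [c₁_eq_supNorm hK]; nlinarith)
  refine ⟨i, hi, fun j hji => ?_⟩
  have e1 := abs_inner_synth_sub_le hΦ x.1 i
  have e2 := abs_inner_synth_sub_le hΦ x.1 j
  have e3 := abs_sub_abs_le_abs_sub (inner ℝ (Φ j) (synth Φ x.1)) (x.1 j)
  have e4 := abs_sub_abs_le_abs_sub (x.1 i) (inner ℝ (Φ i) (synth Φ x.1))
  rw [abs_sub_comm] at e4
  have e5 := supNorm_eq_of_mem_topSet hi
  have e6 := hj j hji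
  nlinarith

/-! ### Perturbations of a dictionary -/

theorem one_sub_inner_sq {u v : E d} (hu : ‖u‖ = 1) (hv : ‖v‖ = 1) :
    1 - (inner ℝ u v : ℝ) ^ 2 = ‖u - v‖ ^ 2 - ‖u - v‖ ^ 4 / 4 := by
  have h := norm_sub_sq_real u v
  rw [hu, hv] at h
  have h2 : (inner ℝ u v : ℝ) = 1 - ‖u - v‖ ^ 2 / 2 := by linarith
  rw [h2]
  ring

theorem norm_le_iSup (w : Fin K → E d) (i : Fin K) : ‖w i‖ ≤ ⨆ i, ‖w i‖ :=
  le_ciSup (f := fun i => ‖w i‖) (Set.finite_range _).bddAbove i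

theorem exists_norm_eq_iSup (hK : 0 < K) (w : Fin K → E d) : ∃ i, ‖w i‖ = ⨆ i, ‖w i‖ := by
  have : Nonempty (Fin K) := ⟨⟨0, hK⟩⟩
  exact exists_eq_ciSup_of_finite

theorem iSup_norm_sub_le_dist (Φ Ψ : Fin K → E d) : ⨆ i, ‖Ψ i - Φ i‖ ≤ dist Ψ Φ :=
  Real.iSup_le (fun i => by rw [← dist_eq_norm]; exact dist_le_pi_dist Ψ Φ i) dist_nonneg

theorem eq_of_iSup_norm_sub_nonpos {Φ Ψ : Fin K → E d} (h : ⨆ i, ‖Ψ i - Φ i‖ ≤ 0) : Ψ = Φ :=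
  funext fun i => sub_eq_zero.1
    (norm_le_zero_iff.1 ((norm_le_iSup (fun i => Ψ i - Φ i) i).trans h))

theorem pos_of_isProbabilityMeasure (ν : Measure (Sph K)) [IsProbabilityMeasure ν] : 0 < K := by
  obtain ⟨x⟩ := nonempty_of_isProbabilityMeasure ν
  rcases Nat.eq_zero_or_pos K with rfl | h
  · simpa using sum_sq_coord x
  · exact h

theorem isLocalMaxOn_of_forall_iSup {Φ : Fin K → E d} {r : ℝ} (hr : 0 < r)
    (h : ∀ Ψ ∈ dictionaries d K, 0 < (⨆ i, ‖Ψ i - Φ i‖) → (⨆ i, ‖Ψ i - Φ i‖) < r →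
      criterion ν Φ Ψ ≤ criterion ν Φ Φ) :
    IsLocalMaxOn (criterion ν Φ) (dictionaries d K) Φ := by
  refine eventually_nhdsWithin_iff.2 ?_
  filter_upwards [Metric.ball_mem_nhds Φ hr] with Ψ hΨr hΨ
  rcases le_or_gt (⨆ i, ‖Ψ i - Φ i‖) 0 with h0 | h0
  · rw [eq_of_iSup_norm_sub_nonpos h0]
  · exact h Ψ hΨ h0 ((iSup_norm_sub_le_dist Φ Ψ).trans_lt hΨr)

/-! ### Tight frames with decaying coefficients -/

theorem exp_sub_div_lt {L s : ℝ} (hL : 4.158 ≤ L) (hs : 0 < s) (hLs : 2 * L * s ≤ 1) :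
    Real.exp (L - L / (4 * s)) < s ^ 2 - s ^ 4 / 4 := by
  obtain ⟨v, hv, rfl⟩ : ∃ v : ℝ, 0 < v ∧ s = v⁻¹ := ⟨s⁻¹, inv_pos.2 hs, (inv_inv s).symm⟩
  have hLv : 2 * L ≤ v := by
    have := mul_le_mul_of_nonneg_right hLs hv.le
    rwa [mul_assoc, inv_mul_cancel₀ hv.ne', mul_one, one_mul] at this
  -- Tangent line of `log` at `8`, close to the smallest admissible `v ≥ 2 L ≥ 8.316`.
  have hlog : Real.log v ≤ v / 8 + 1.07945 := by
    have h1 := Real.log_le_sub_one_of_pos (show 0 < v / 8 by positivity)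
    have h2 : Real.log 8 = 3 * Real.log 2 := by
      rw [show (8 : ℝ) = 2 ^ 3 by norm_num, Real.log_pow]; norm_num
    rw [Real.log_div hv.ne' (by norm_num), h2] at h1
    have := Real.log_two_lt_d9
    linarith
  -- The slack `0.01` pays for the factor `1 - s² / 4`, which is at least `1 - 1 / 256` as `s ≤ 1 /
  -- 8`.
  have hexp : L - L / (4 * v⁻¹) < -(2 * Real.log v) + -0.01 := by
    have : L / (4 * v⁻¹) = L * v / 4 := by field_simp
    rw [this]
    nlinarith
  have hsq : Real.exp (-(2 * Real.log v)) = v⁻¹ ^ 2 := by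
    rw [Real.exp_neg, two_mul, Real.exp_add, Real.exp_log hv, ← sq, inv_pow]
  have hsmall : v⁻¹ ≤ 1 / 8 := by
    rw [inv_le_comm₀ hv (by norm_num)]
    norm_num
    linarith
  have hfac : Real.exp (-0.01) ≤ 1 - v⁻¹ ^ 2 / 4 := by
    have h1 : Real.exp (-0.01) ≤ 1 / 1.01 := by
      rw [Real.exp_neg, one_div]
      exact inv_anti₀ (by norm_num) (by linarith [Real.add_one_le_exp (0.01 : ℝ)])
    nlinarith [inv_pos.2 hv]
  calc Real.exp (L - L / (4 * v⁻¹)) < Real.exp (-(2 * Real.log v) + -0.01) := Real.exp_lt_exp.2 hexp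
    _ = v⁻¹ ^ 2 * Real.exp (-0.01) := by rw [Real.exp_add, hsq]
    _ ≤ v⁻¹ ^ 2 * (1 - v⁻¹ ^ 2 / 4) := mul_le_mul_of_nonneg_left hfac (sq_nonneg _)
    _ = _ := by ring

/-- With at most 30 other coordinates, `1 ≤ ‖x‖_∞² + 30 c₂²`. Inserting `c₂ ≤ (1 - b) / (1 + b) ·
‖x‖_∞` and multiplying by `b²` leaves the factor `b² + 30 (b (1 - b) / (1 + b))² ≤ 1 + 0.9`. -/
theorem supNorm_lower_bound (hK : 0 < K) (hK' : K ≤ 31) {b : ℝ} (hb : 0 ≤ b) (x : Sph K)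
    (hx : (1 + b) * c₂ x.1 ≤ (1 - b) * supNorm x) : b ^ 2 ≤ 1.9 * supNorm x ^ 2 := by
  have h1 := one_le_rearr hK x
  have h2 := c₂_nonneg x.1
  have hM := supNorm_pos x
  have hK1 : (K : ℝ) - 1 ≤ 30 := by
    have : (K : ℝ) ≤ 31 := by exact_mod_cast hK'
    linarith
  have h3 : ((1 + b) * c₂ x.1) ^ 2 ≤ ((1 - b) * supNorm x) ^ 2 :=
    pow_le_pow_left₀ (by positivity) hx 2
  have h4 : 1 ≤ supNorm x ^ 2 + 30 * c₂ x.1 ^ 2 := by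
    nlinarith [sq_nonneg (c₂ x.1)]
  have hb1 : b ≤ 1 := by
    by_contra! h
    have : 0 ≤ (1 + b) * c₂ x.1 := by positivity
    nlinarith
  have h5 : 30 * (b * (1 - b)) ^ 2 ≤ 0.9 * (1 + b) ^ 2 := by
    -- The maximum of `b (1 - b) / (1 + b)` on `[0, 1]` is `3 - 2√2 ≈ 0.1716`, while `30 · 0.1732² <
    -- 0.9`; the shift `0.4134 = (1 - 0.1732) / 2` completes the square.
    have h6 : b * (1 - b) ≤ 0.1732 * (1 + b) := by nlinarith [sq_nonneg (b - 0.4134)]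
    have h7 := pow_le_pow_left₀ (mul_nonneg hb (by linarith)) h6 2
    nlinarith [sq_nonneg (1 + b)]
  have h8 : (1 + b) ^ 2 * b ^ 2 ≤ (1 + b) ^ 2 * (1.9 * supNorm x ^ 2) := by
    have e1 : (1 + b) ^ 2 * b ^ 2 ≤
        b ^ 2 * ((1 + b) ^ 2 * supNorm x ^ 2 + 30 * ((1 + b) * c₂ x.1) ^ 2) := by
      nlinarith [mul_le_mul_of_nonneg_left h4 (by positivity : 0 ≤ b ^ 2 * (1 + b) ^ 2)]
    have e2 : b ^ 2 * ((1 + b) ^ 2 * supNorm x ^ 2 + 30 * ((1 + b) * c₂ x.1) ^ 2) ≤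
        b ^ 2 * ((1 + b) ^ 2 * supNorm x ^ 2 + 30 * ((1 - b) * supNorm x) ^ 2) := by gcongr
    have e3 : 30 * (b * (1 - b)) ^ 2 * supNorm x ^ 2 ≤ 0.9 * (1 + b) ^ 2 * supNorm x ^ 2 := by
      gcongr
    have e4 : b ^ 2 * ((1 + b) ^ 2 * supNorm x ^ 2) ≤ 1 * ((1 + b) ^ 2 * supNorm x ^ 2) := by
      gcongr
      exact pow_le_one₀ hb hb1
    nlinarith
  exact le_of_mul_le_mul_left h8 (by positivity)

/-- Cauchy–Schwarz alone suffices here: the squared response is at most `ε² A ≤ b⁴ / (4 A L²)`, and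
`b² ≤ 1.9 ‖x‖_∞² ≤ L² ‖x‖_∞²`. -/
theorem notMem_deviation_of_small {Φ : Fin K → E d} {A b L ε : ℝ} (hA1 : 1 ≤ A)
    (hA : ∀ v : E d, ∑ i, (inner ℝ (Φ i) v) ^ 2 = A * ‖v‖ ^ 2) {w : E d} (hw : ‖w‖ ≤ ε)
    (hb : 0 ≤ b) (hL : 1.9 ≤ L ^ 2) (hL0 : 0 ≤ L) (hε : ε * (2 * A * L) ≤ b ^ 2) {x : Sph K}
    (hx : b ^ 2 ≤ 1.9 * supNorm x ^ 2) : x ∉ deviation Φ w (b / 2) := by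
  have hM := supNorm_pos x
  have hε0 : 0 ≤ ε := (norm_nonneg w).trans hw
  have hbM : 0 ≤ b / 2 * supNorm x := by positivity
  refine not_lt.2 (abs_le_of_sq_le_sq ?_ hbM)
  have h1 : (inner ℝ w (synth Φ x.1) : ℝ) ^ 2 ≤ ε ^ 2 * A := by
    rw [← sq_abs]
    refine (pow_le_pow_left₀ (abs_nonneg _) (abs_real_inner_le_norm _ _) 2).trans ?_
    rw [mul_pow]
    exact mul_le_mul (pow_le_pow_left₀ (norm_nonneg _) hw 2)
      (norm_synth_sq_le (by linarith) hA x) (sq_nonneg _) (sq_nonneg _)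
  have h2 : 4 * (ε ^ 2 * A) * L ^ 2 ≤ b ^ 2 * supNorm x ^ 2 * L ^ 2 := by
    have e1 : (ε * (2 * A * L)) ^ 2 ≤ (b ^ 2) ^ 2 := pow_le_pow_left₀ (by positivity) hε 2
    have e2 : 4 * (ε ^ 2 * A) * L ^ 2 * 1 ≤ 4 * (ε ^ 2 * A) * L ^ 2 * A := by gcongr
    have e3 : b ^ 2 * b ^ 2 ≤ b ^ 2 * (L ^ 2 * supNorm x ^ 2) := by
      refine mul_le_mul_of_nonneg_left (hx.trans ?_) (sq_nonneg b)
      gcongr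
    nlinarith
  have h3 := le_of_mul_le_mul_right h2 (by linarith)
  nlinarith

/-- The radius condition gives `b² ≥ 2 A L ‖w‖`, so the tail exponent is at least `L / (4 ‖w‖)`.
Since `2 A = (lam / K) exp L`, the claim reduces to `exp_sub_div_lt`. -/
theorem mul_measureReal_deviation_lt [IsProbabilityMeasure ν] (h : IsSymmetric ν)
    {Φ : Fin K → E d} {A b L ε lam : ℝ} (hK : 32 ≤ K) (hA1 : 1 ≤ A)
    (hA : ∀ v : E d, ∑ i, (inner ℝ (Φ i) v) ^ 2 = A * ‖v‖ ^ 2) {w : E d} (hw0 : 0 < ‖w‖)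
    (hw : ‖w‖ ≤ ε) (hb : 0 ≤ b) (hb1 : b ≤ 1) (hlam : 0 < lam)
    (hLexp : Real.exp L = 2 * A * K / lam) (hL : 4.158 ≤ L) (hε : ε * (2 * A * L) ≤ b ^ 2) :
    A * ν.real (deviation Φ w (b / 2)) < lam / K * (‖w‖ ^ 2 - ‖w‖ ^ 4 / 4) := by
  have hA0 : 0 < A := by linarith
  have hL0 : 0 < L := by linarith
  have hK0 : (0 : ℝ) < K := by exact_mod_cast (by omega : 0 < K)
  have h1 := measureReal_deviation_le h hA0.le (show 0 ≤ b / 2 by positivity) hA w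
  have h2 : ‖w‖ * (2 * A * L) ≤ b ^ 2 :=
    (mul_le_mul_of_nonneg_right hw (by positivity)).trans hε
  have h3 : L / (4 * ‖w‖) ≤ (b / 2) ^ 2 / (2 * (A * ‖w‖ ^ 2)) := by
    rw [div_le_div_iff₀ (by positivity) (by positivity)]
    nlinarith
  have h4 : 2 * L * ‖w‖ ≤ 1 := by
    have e1 : b ^ 2 ≤ 1 := pow_le_one₀ hb hb1
    have e2 : ‖w‖ * L * 1 ≤ ‖w‖ * L * A := by gcongr
    linarith
  calc A * ν.real (deviation Φ w (b / 2))
      ≤ A * (2 * Real.exp (-(L / (4 * ‖w‖)))) := by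
        refine mul_le_mul_of_nonneg_left (h1.trans ?_) hA0.le
        gcongr
    _ = lam / K * Real.exp (L - L / (4 * ‖w‖)) := by
        rw [sub_eq_add_neg, Real.exp_add, hLexp]
        field_simp
    _ < _ := mul_lt_mul_of_pos_left (exp_sub_div_lt hL hw0 h4) (by positivity)

theorem criterion_lt_of_deviation [IsProbabilityMeasure ν] (h : IsSymmetric ν)
    {Φ Ψ : Fin K → E d} {A m : ℝ} (hΦ : Φ ∈ dictionaries d K) (hΨ : Ψ ∈ dictionaries d K)
    (hK : 0 < K) (hA0 : 0 ≤ A) (hA : ∀ v : E d, ∑ i, (inner ℝ (Φ i) v) ^ 2 = A * ‖v‖ ^ 2)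
    (hm : 0 ≤ m)
    (hsep : ∀ᵐ x ∂ν, ∃ i, x ∈ topSet i ∧ ∀ j, j ≠ i →
      |inner ℝ (Φ j) (synth Φ x.1)| + 2 * (m * supNorm x) ≤ |inner ℝ (Φ i) (synth Φ x.1)|)
    (hne : 0 < ⨆ i, ‖Ψ i - Φ i‖)
    (hdev : ∀ j, 0 < ‖Ψ j - Φ j‖ → A * ν.real (deviation Φ (Ψ j - Φ j) m) <
      momentGap ν / K * (‖Ψ j - Φ j‖ ^ 2 - ‖Ψ j - Φ j‖ ^ 4 / 4)) :
    criterion ν Φ Ψ < criterion ν Φ Φ := by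
  have hT : ∀ᵐ x ∂ν, ∃ i, x ∈ topSet i := hsep.mono fun x ⟨i, hi, _⟩ => ⟨i, hi⟩
  have h1 := criterion_le_lead hΨ hA0 hA (N := ∅) (hsep.mono fun x hx => Or.inr hx)
  have h2 := integral_lead_sub h hK hT hΦ hΨ hA
  have h3 := integral_lead_le_criterion hT Φ Φ
  have h4 : ∑ j, A * ν.real (deviation Φ (Ψ j - Φ j) m) <
      momentGap ν / K * ∑ j, (1 - (inner ℝ (Ψ j) (Φ j)) ^ 2) := by
    rw [Finset.mul_sum]
    simp only [fun j => one_sub_inner_sq (hΨ j) (hΦ j)]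
    obtain ⟨j, hj⟩ := exists_norm_eq_iSup hK fun i => Ψ i - Φ i
    refine Finset.sum_lt_sum (fun k _ => ?_) ⟨j, Finset.mem_univ j, hdev j (hj ▸ hne)⟩
    rcases eq_or_ne (Ψ k - Φ k) 0 with hk | hk
    · rw [hk, deviation_zero Φ hm]
      simp
    · exact (hdev k (norm_pos_iff.2 hk)).le
  rw [measureReal_empty] at h1
  linarith

theorem two_mul_le_argument {A lam : ℝ} (hA1 : 1 ≤ A) (hlam : 0 < lam) (hlam1 : lam ≤ 1) :
    2 * (K : ℝ) ≤ 2 * A * K / lam := by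
  rw [le_div_iff₀ hlam]
  have e1 : 2 * (K : ℝ) * lam ≤ 2 * K * 1 := by gcongr
  have e2 : 2 * (K : ℝ) * 1 ≤ 2 * K * A := by gcongr
  linarith

theorem log_argument_pos [IsProbabilityMeasure ν] (hK : 0 < K)
    (hT : ∀ᵐ x ∂ν, ∃ i, x ∈ topSet i) {A : ℝ} (hA1 : 1 ≤ A) :
    0 < Real.log (2 * A * K / momentGap ν) := by
  have h1 := two_mul_le_argument (K := K) hA1 (momentGap_pos hK hT) (momentGap_le_one hK)
  have hK' : (1 : ℝ) ≤ K := by exact_mod_cast hK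
  exact Real.log_pos (by linarith)

theorem criterion_lt_of_decaying [IsProbabilityMeasure ν] (h : IsSymmetric ν)
    {Φ Ψ : Fin K → E d} {A β ε : ℝ} (hΦ : Φ ∈ dictionaries d K) (hΨ : Ψ ∈ dictionaries d K)
    (hK : 0 < K) (hA1 : 1 ≤ A) (hA : ∀ v : E d, ∑ i, (inner ℝ (Φ i) v) ^ 2 = A * ‖v‖ ^ 2)
    (hdec : IsDecaying ν β (coherence Φ)) (hne : 0 < ⨆ i, ‖Ψ i - Φ i‖)
    (hle : ⨆ i, ‖Ψ i - Φ i‖ ≤ ε) (hε : ε < 1 / 5)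
    (hε' : ε ≤ (1 - 2 * β) ^ 2 / (2 * A * Real.log (2 * A * K / momentGap ν))) :
    criterion ν Φ Ψ < criterion ν Φ Φ := by
  obtain ⟨hβ, hae⟩ := hdec
  have hsep := hae.mono fun x hx => separation_of_decaying hΦ hK hβ hx
  have hT : ∀ᵐ x ∂ν, ∃ i, x ∈ topSet i := hsep.mono fun x ⟨i, hi, _⟩ => ⟨i, hi⟩
  have hlam := momentGap_pos hK hT
  have harg := two_mul_le_argument (K := K) hA1 hlam (momentGap_le_one hK)
  have hL0 := log_argument_pos hK hT hA1
  have hLexp : Real.exp (Real.log (2 * A * K / momentGap ν)) = 2 * A * K / momentGap ν := by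
    refine Real.exp_log ?_
    have : (0 : ℝ) < K := by exact_mod_cast hK
    positivity
  have hLK : Real.log (2 * K) ≤ Real.log (2 * A * K / momentGap ν) :=
    Real.log_le_log (by have : (0 : ℝ) < K := by exact_mod_cast hK
                        positivity) harg
  generalize Real.log (2 * A * K / momentGap ν) = L at hL0 hLexp hLK hε'
  rw [le_div_iff₀ (by positivity)] at hε'
  have hb : 0 ≤ 1 - 2 * β := by linarith
  have hK0 : (0 : ℝ) < K := by exact_mod_cast hK
  refine criterion_lt_of_deviation h hΦ hΨ hK (by linarith) hA
    (show 0 ≤ (1 - 2 * β) / 2 by linarith) hsep hne fun j hj => ?_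
  have hjε : ‖Ψ j - Φ j‖ ≤ ε := (norm_le_iSup (fun i => Ψ i - Φ i) j).trans hle
  -- The bound `ε < 1 / 5` excludes `ψ_j = -φ_j`, at distance `2`, where the loss vanishes.
  have hloss : 0 < ‖Ψ j - Φ j‖ ^ 2 - ‖Ψ j - Φ j‖ ^ 4 / 4 := by
    have : ‖Ψ j - Φ j‖ ^ 2 < 1 := by nlinarith
    nlinarith [pow_pos hj 2]
  have hlog2 := Real.log_two_gt_d9
  -- For `K ≥ 32`, `L ≥ log 64 > 4.158`, as the tail estimate requires; for `2 ≤ K ≤ 31`, `L ≥ log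
  -- 4` gives `L² ≥ 1.9`, which makes the deviations null.
  rcases le_or_gt K 31 with hK31 | hK31
  · rcases Nat.eq_or_lt_of_le (Nat.succ_le_of_lt hK) with hK1 | hK1
    -- A single atom has `⟨φ, ψ⟩² = A ≥ 1`, contradicting the positive loss.
    · exfalso
      subst hK1
      have h1 := hA (Ψ j)
      rw [hΨ, Fin.sum_univ_one, Subsingleton.elim 0 j] at h1
      have h2 := one_sub_inner_sq (hΨ j) (hΦ j)
      rw [real_inner_comm] at h2
      linarith
    · have hL : 1.9 ≤ L ^ 2 := by
        have h1 : Real.log (2 ^ 2) ≤ Real.log (2 * K) := by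
          refine Real.log_le_log (by norm_num) ?_
          have : (2 : ℝ) ≤ K := by exact_mod_cast hK1
          linarith
        rw [Real.log_pow] at h1
        push_cast at h1
        nlinarith
      have hnull : ν.real (deviation Φ (Ψ j - Φ j) ((1 - 2 * β) / 2)) = 0 := by
        rw [measureReal_eq_zero_iff]
        refine measure_mono_null (t := {x | ¬ _}) ?_ (ae_iff.1 hae)
        intro x hxd hx
        refine notMem_deviation_of_small hA1 hA hjε hb hL hL0.le hε'
          (supNorm_lower_bound hK hK31 hb x ?_) hxd
        have hM := supNorm_pos x
        have hc := c₂_nonneg x.1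
        rw [c₁_eq_supNorm hK, div_le_iff₀ (by linarith)] at hx
        have hnn : 0 ≤ coherence Φ * ∑ i, rearr x.1 i :=
          mul_nonneg (coherence_nonneg Φ) (Finset.sum_nonneg fun _ _ => abs_nonneg _)
        linarith
      rw [hnull, mul_zero]
      positivity
  · have hL : 4.158 ≤ L := by
      have h1 : Real.log (2 ^ 6) ≤ Real.log (2 * K) := by
        refine Real.log_le_log (by norm_num) ?_
        have : (32 : ℝ) ≤ K := by exact_mod_cast hK31
        linarith
      rw [Real.log_pow] at h1
      push_cast at h1
      linarith
    -- This is `β ≥ 0`: the decay ratio is nonnegative and at most `β` at some point.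
    have hb1 : 1 - 2 * β ≤ 1 := by
      obtain ⟨x, hx⟩ := hae.exists
      have : 0 ≤ (c₂ x.1 + coherence Φ * ∑ i, rearr x.1 i) / (c₂ x.1 + c₁ x.1) := by
        have h1 := c₂_nonneg x.1
        have h2 := c₂_le_c₁ hK x.1
        have hnn : 0 ≤ coherence Φ * ∑ i, rearr x.1 i :=
          mul_nonneg (coherence_nonneg Φ) (Finset.sum_nonneg fun _ _ => abs_nonneg _)
        exact div_nonneg (by linarith) (by linarith)
      linarith
    exact mul_measureReal_deviation_lt h hK31 hA1 hA hj hjε hb hb1 hlam hLexp hL hε'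

/-! ### Orthonormal bases -/

theorem tendsto_zero_of_isLittleO_sq {g : ℝ → ℝ}
    (hg : g =o[𝓝[>] 0] fun ε : ℝ => ε ^ 2) : Tendsto g (𝓝[>] 0) (𝓝 0) :=
  hg.trans_tendsto (tendsto_nhdsWithin_of_tendsto_nhds
    ((continuous_pow 2).tendsto' (0 : ℝ) 0 (by norm_num)))

/-- As `f ≥ 0`, ties lie in every exceptional set, whose probability tends to `0`. -/
theorem ae_c₂_lt_c₁ [IsProbabilityMeasure ν] (hK : 0 < K) {f : ℝ → ℝ} (hf : IsFDecaying ν f) :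
    ∀ᵐ x ∂ν, c₂ x.1 < c₁ x.1 := by
  have h1 : ν.real {x : Sph K | 1 ≤ c₂ x.1 / c₁ x.1} ≤ 0 := by
    refine ge_of_tendsto (tendsto_zero_of_isLittleO_sq hf.2.2) ?_
    filter_upwards [self_mem_nhdsWithin] with ε hε
    refine measureReal_mono fun x hx => ?_
    change 1 - f ε ≤ c₂ x.1 / c₁ x.1
    have := hf.1 ε hε
    have hx' : 1 ≤ c₂ x.1 / c₁ x.1 := hx
    linarith
  have h2 := (measureReal_eq_zero_iff).1 (le_antisymm h1 measureReal_nonneg)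
  filter_upwards [measure_eq_zero_iff_ae_notMem.1 h2] with x hx
  have hpos : 0 < c₁ x.1 := by rw [c₁_eq_supNorm hK]; exact supNorm_pos x
  have hx' : ¬ 1 ≤ c₂ x.1 / c₁ x.1 := hx
  rwa [one_le_div hpos, not_le] at hx'

theorem inner_synth_orthonormalBasis (Φ : OrthonormalBasis (Fin d) ℝ (E d)) (x : E d)
    (i : Fin d) : inner ℝ (Φ i) (synth (fun i => Φ i) x) = x i := by
  simp [inner_synth, Φ.inner_eq_ite]

theorem separation_of_ratio_lt {Φ : OrthonormalBasis (Fin d) ℝ (E d)} (hd : 0 < d) {x : Sph d}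
    (hx : c₂ x.1 < c₁ x.1) {t : ℝ} (ht : c₂ x.1 / c₁ x.1 < 1 - t) :
    ∃ i, x ∈ topSet i ∧ ∀ j, j ≠ i →
      |inner ℝ (Φ j) (synth (fun i => Φ i) x.1)| + 2 * (t / 2 * supNorm x) ≤
        |inner ℝ (Φ i) (synth (fun i => Φ i) x.1)| := by
  obtain ⟨i, hi, hj⟩ := exists_mem_topSet hd hx
  rw [c₁_eq_supNorm hd, div_lt_iff₀ (supNorm_pos x)] at ht
  refine ⟨i, hi, fun j hji => ?_⟩
  rw [inner_synth_orthonormalBasis, inner_synth_orthonormalBasis, ← supNorm_eq_of_mem_topSet hi]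
  linarith [hj j hji]

theorem mul_measureReal_deviation_le [IsProbabilityMeasure ν] (h : IsSymmetric ν)
    {Φ : Fin K → E d} {m ε : ℝ} (hm : 0 ≤ m)
    (hA : ∀ v : E d, ∑ i, (inner ℝ (Φ i) v) ^ 2 = 1 * ‖v‖ ^ 2) {w : E d} (hw : ‖w‖ ≤ ε) :
    1 * ν.real (deviation Φ w m) ≤ 2 * Real.exp (-(m ^ 2 / (2 * ε ^ 2))) := by
  rcases eq_or_ne w 0 with rfl | h0
  · rw [deviation_zero Φ hm]
    simpa using (Real.exp_pos _).le
  · have hw0 : 0 < ‖w‖ := norm_pos_iff.2 h0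
    rw [one_mul]
    refine (measureReal_deviation_le h zero_le_one hm hA w).trans ?_
    rw [one_mul]
    gcongr

theorem isLocalMaxOn_of_fDecaying {Φ : OrthonormalBasis (Fin d) ℝ (E d)} {ν : Measure (Sph d)}
    [IsProbabilityMeasure ν] (h : IsSymmetric ν) {f : ℝ → ℝ} (hf : IsFDecaying ν f) :
    IsLocalMaxOn (criterion ν fun i => Φ i) (dictionaries d d) fun i => Φ i := by
  have hd := pos_of_isProbabilityMeasure ν
  have hd0 : (0 : ℝ) < d := by exact_mod_cast hd
  have hΦ : (fun i => Φ i) ∈ dictionaries d d := fun i => Φ.norm_eq_one i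
  have hA : ∀ v : E d, ∑ i, (inner ℝ (Φ i) v) ^ 2 = 1 * ‖v‖ ^ 2 := fun v => by
    rw [one_mul, Φ.sum_sq_inner_right]
  have hlt := ae_c₂_lt_c₁ hd hf
  have hT : ∀ᵐ x ∂ν, ∃ i, x ∈ topSet i := hlt.mono fun x hx =>
    let ⟨i, hi, _⟩ := exists_mem_topSet hd hx; ⟨i, hi⟩
  have hgap := momentGap_pos hd hT
  set κ := momentGap ν / d with hκ
  have hκ0 : 0 < κ := div_pos hgap hd0
  -- Error budget: the `d` deviations cost at most `d · 2 · κ ε² / (8 d) = κ ε² / 4` and the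
  -- exceptional set another `κ ε² / 4`. The most displaced atom alone loses at least `3 κ ε² / 4`
  -- when `ε < 1`.
  obtain ⟨r, hr, hsmall⟩ := mem_nhdsGT_iff_exists_Ioo_subset.1
    ((hf.2.1.def (show 0 < κ / (8 * d) by positivity)).and
      (hf.2.2.def (show 0 < κ / 4 by positivity)))
  refine isLocalMaxOn_of_forall_iSup (lt_min (show (0 : ℝ) < r from hr) one_pos)
    fun Ψ hΨ h0 hlt' => ?_
  obtain ⟨hlt1, hlt2⟩ := lt_min_iff.1 hlt'
  obtain ⟨j, hj⟩ := exists_norm_eq_iSup hd fun i => Ψ i - Φ i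
  have hnorm := norm_le_iSup fun i => Ψ i - Φ i
  -- The scale at which `f` is evaluated is the actual displacement of `Ψ`.
  generalize (⨆ i, ‖Ψ i - Φ i‖) = ε at *
  obtain ⟨b1, b2⟩ := hsmall ⟨h0, hlt1⟩
  rw [Real.norm_of_nonneg (Real.exp_pos _).le, Real.norm_of_nonneg (sq_nonneg ε)] at b1
  rw [Real.norm_of_nonneg measureReal_nonneg, Real.norm_of_nonneg (sq_nonneg ε)] at b2
  have hm : 0 ≤ f ε / 2 := by linarith [hf.1 ε h0]
  have h1 := criterion_le_lead (ν := ν) (m := f ε / 2) hΨ zero_le_one hA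
    (N := {x : Sph d | c₂ x.1 / c₁ x.1 ≥ 1 - f ε}) (by
      filter_upwards [hlt] with x hx
      by_cases hxN : c₂ x.1 / c₁ x.1 ≥ 1 - f ε
      · exact Or.inl hxN
      · exact Or.inr (separation_of_ratio_lt hd hx (not_le.1 hxN)))
  have h2 := integral_lead_sub h hd hT hΦ hΨ hA
  have h3 := integral_lead_le_criterion hT (fun i => Φ i) fun i => Φ i
  have h4 : ∑ k, 1 * ν.real (deviation (fun i => Φ i) (Ψ k - Φ k) (f ε / 2)) ≤ κ / 4 * ε ^ 2 := by
    have e1 := Finset.sum_le_card_nsmul Finset.univ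
      (fun k => 1 * ν.real (deviation (fun i => Φ i) (Ψ k - Φ k) (f ε / 2)))
      (2 * (κ / (8 * d) * ε ^ 2)) fun k _ => by
        refine (mul_measureReal_deviation_le h hm hA (hnorm k)).trans ?_
        rw [show (f ε / 2) ^ 2 / (2 * ε ^ 2) = f ε ^ 2 / (8 * ε ^ 2) by field_simp; norm_num]
        exact mul_le_mul_of_nonneg_left b1 zero_le_two
    refine e1.trans (le_of_eq ?_)
    simp
    field_simp
    norm_num
  have hloss : ∀ k, 0 ≤ 1 - (inner ℝ (Ψ k) (Φ k) : ℝ) ^ 2 := fun k => by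
    have e1 := abs_real_inner_le_norm (Ψ k) (Φ k)
    rw [hΨ, Φ.norm_eq_one, one_mul] at e1
    linarith [(sq_le_one_iff_abs_le_one _).2 e1]
  have h5 := Finset.single_le_sum (fun k _ => hloss k) (Finset.mem_univ j)
  rw [one_sub_inner_sq (hΨ j) (Φ.norm_eq_one j), hj] at h5
  have h6 : 3 / 4 * ε ^ 2 ≤ ε ^ 2 - ε ^ 4 / 4 := by
    nlinarith [mul_le_of_le_one_right (sq_nonneg ε) (pow_le_one₀ (n := 2) h0.le hlt2.le)]
  have h7 := mul_le_mul_of_nonneg_left (h6.trans h5) hκ0.le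
  have h8 : 0 ≤ κ * ε ^ 2 := by positivity
  linarith

end KSVD

theorem mainTheorem3 :
    -- (a) unit norm tight frames with coherence `μ` and `(β, μ)`-decaying coefficients
    (∀ (d K : ℕ) (Φ : Fin K → KSVD.E d) (ν : Measure (KSVD.Sph K)) (β : ℝ),
      IsProbabilityMeasure ν →
      Φ ∈ KSVD.dictionaries d K → KSVD.IsTightFrame Φ →
      KSVD.IsSymmetric ν → KSVD.IsDecaying ν β (KSVD.coherence Φ) →
      IsLocalMaxOn (KSVD.criterion ν Φ) (KSVD.dictionaries d K) Φ ∧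
      ∀ (Ψ : Fin K → KSVD.E d) (ε : ℝ), Ψ ∈ KSVD.dictionaries d K →
        0 < (⨆ i, ‖Ψ i - Φ i‖) → (⨆ i, ‖Ψ i - Φ i‖) ≤ ε →
        ε < 1 / 5 →
        ε ≤ (1 - 2 * β) ^ 2 /
          (2 * ((K : ℝ) / d) * Real.log (2 * ((K : ℝ) / d) * K /
            (KSVD.meanSupSq ν - (1 - KSVD.meanSupSq ν) / ((K : ℝ) - 1)))) →
        KSVD.criterion ν Φ Ψ < KSVD.criterion ν Φ Φ) ∧
    -- (b) orthonormal bases and `f`-decaying coefficients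
    (∀ (d : ℕ) (Φ : OrthonormalBasis (Fin d) ℝ (KSVD.E d)) (ν : Measure (KSVD.Sph d))
      (f : ℝ → ℝ),
      IsProbabilityMeasure ν → KSVD.IsSymmetric ν → KSVD.IsFDecaying ν f →
      IsLocalMaxOn (KSVD.criterion ν (fun i => Φ i)) (KSVD.dictionaries d d)
        (fun i => Φ i)) := by
  refine ⟨fun d K Φ ν β _ hΦ hframe hsym hdec => ?_,
    fun d Φ ν f _ hsym hf => KSVD.isLocalMaxOn_of_fDecaying hsym hf⟩
  have hK := KSVD.pos_of_isProbabilityMeasure ν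
  obtain ⟨A, -, -, hbounds⟩ := hframe
  have hA : ∀ v : KSVD.E d, ∑ i, (inner ℝ (Φ i) v) ^ 2 = A * ‖v‖ ^ 2 := fun v => by
    simpa only [sq_abs] using le_antisymm (hbounds v).2 (hbounds v).1
  obtain ⟨hAeq, hA1⟩ := KSVD.tightFrame_const hΦ hK hA
  have key : ∀ (Ψ : Fin K → KSVD.E d) (ε : ℝ), Ψ ∈ KSVD.dictionaries d K →
      0 < (⨆ i, ‖Ψ i - Φ i‖) → (⨆ i, ‖Ψ i - Φ i‖) ≤ ε → ε < 1 / 5 →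
      ε ≤ (1 - 2 * β) ^ 2 / (2 * A * Real.log (2 * A * K / KSVD.momentGap ν)) →
      KSVD.criterion ν Φ Ψ < KSVD.criterion ν Φ Φ := fun Ψ ε hΨ hne hle hε hε' =>
    KSVD.criterion_lt_of_decaying hsym hΦ hΨ hK hA1 hA hdec hne hle hε hε'
  refine ⟨?_, hAeq ▸ key⟩
  have hT : ∀ᵐ x ∂ν, ∃ i, x ∈ KSVD.topSet i := hdec.2.mono fun x hx =>
    let ⟨i, hi, _⟩ := KSVD.separation_of_decaying hΦ hK hdec.1 hx; ⟨i, hi⟩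
  have hL := KSVD.log_argument_pos hK hT hA1
  have hβ := sub_pos.2 hdec.1
  have hr : 0 < (1 - 2 * β) ^ 2 / (2 * A * Real.log (2 * A * K / KSVD.momentGap ν)) :=
    div_pos (pow_pos (by linarith) 2) (by positivity)
  exact KSVD.isLocalMaxOn_of_forall_iSup (lt_min (show (0 : ℝ) < 1 / 5 by norm_num) hr)
    fun Ψ hΨ hne hlt => (key Ψ _ hΨ hne le_rfl (hlt.trans_le (min_le_left _ _))
      (hlt.le.trans (min_le_right _ _))).le
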